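/- **Setting.** Let $A$ be a well-ordered set of order type $o$. Give $\mathbb R^o=\prod_{a\in A}\mathbb R$ and $\mathbb Z^o=\prod_{a\in A}\mathbb Z\subset\mathbb R^o$ the lexicographic order. A *transfinite word* is a map $w:S\to A\cup A^{-1}$ from a totally ordered set $S$ with finite fibres, taken up to order isomorphism. A *cancellation* of $w$ is an involution $t\mapsto t^*$ of a subset $T\subseteq S$ such that, for all $t\in T$, $[t,t^*]_S\subseteq T$, $([t,t^*]_S)^*=[t,t^*]_S$ and $w(t^*)=w(t)^{-1}$; it yields the word $w|_{S\setminus T}$. A word is *reduced* if it has no nonempty cancellation. The big free group $BF(o)$ is the set of transfinite words modulo the equivalence relation generated by cancellation, with concatenation as product; every class contains exactly one reduced word. For $g\in BF(o)$ let $L(g)\in\mathbb Z^o$ have $a$-coordinate the number of occurrences of $a$ and $a^{-1}$ in the reduced word of $g$, and let $c(g,h)=\frac12\bigl(L(g)+L(h)-L(g^{-1}h)\bigr)$. The points of the big Cayley graph $\Gamma(BF(o))$ are the elements $w\in BF(o)$ (vertices) and the triples $(w,a^p,t)$ with $w\in BF(o)$, $a\in A$, $p=\pm1$, $0<t<1$,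 such that the reduced word $w$ does not end in $a^{-p}$. A vertex $w$ is also regarded as a triple with $t=0$ and no second coordinate (so that $wa^p$ and $L(w)+tL(a)$ below then mean $w$ and $L(w)$). For $u\in BF(o)$ put $u\cdot w=uw$, and $u\cdot(w,a^p,t)=(uw,a^p,t)$ if $uw$ does not end in $a^{-p}$, $u\cdot(w,a^p,t)=(uwa^p,a^{-p},1-t)$ if it does. Define $$d\bigl((w,a^p,t),(v,b^q,s)\bigr)=L(w)+tL(a)+L(v)+sL(b)-2\min\{L(w)+tL(a),\,L(v)+sL(b),\,c(wa^p,vb^q)\}\in\mathbb R^o .$$ For an ordered abelian group $\Lambda$, a $\Lambda$-metric is a $\Lambda$-valued function with the usual axioms of a metric. A *segment* in a $\Lambda$-metric space is the image of an isometry from an interval $[a,b]_\Lambda$ (with distance $|s-t|$), a *geodesic*. A *$\Lambda$-tree* is a $\Lambda$-metric space in which any two points are the endpoints of a segment, the union of two segments which meet in exactly one point, an endpoint of both, is a segment, and the intersection of two segments with a common endpoint is a segment. With $(x\cdot y)_z=\frac12(d(z,x)+d(z,y)-d(x,y))$, the space is *$0$-hyperbolic* if $(x\cdot y)_z\ge\min\{(x\cdot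 r)_z,(y\cdot r)_z\}$ for all $x,y,r,z$. Let $T(BF(o))$ be the disjoint union of the intervals $[0,L(g)]_{\mathbb Z^o}$, $g\in BF(o)$, with $n\in[0,L(g)]$ and $n\in[0,L(h)]$ identified if $n\le c(g,h)$; write $\langle n,g\rangle$ for the class of $n\in[0,L(g)]$, identify $g$ with $\langle L(g),g\rangle$, and put $d(\langle n,g\rangle,\langle m,h\rangle)=n+m-2\min\{n,m,c(g,h)\}$. **Claim.** 1. $d$ is an $\mathbb R^o$-metric on $\Gamma(BF(o))$, it satisfies $d(w,v)=L(w^{-1}v)$ for $w,v\in BF(o)$, and $(\Gamma(BF(o)),d)$ is $0$-hyperbolic. 2. The formulas above define an action of $BF(o)$ on $\Gamma(BF(o))$, and this action is by isometries. 3. There are an $\mathbb R^o$-tree $X$ with an action of $BF(o)$ by isometries and a distance-preserving $BF(o)$-equivariant map $\varphi:\Gamma(BF(o))\to X$. Moreover, for each $w\in BF(o)$ there is a geodesic $\alpha:[0,L(w)]_{\mathbb R^o}\to X$ from $\varphi(1)$ to $\varphi(w)$ such that, whenever $w=va^p$ with $v$ not ending in $a^{-p}$, $\alpha(L(v))=\varphi(v)$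 and $\alpha(L(v)+tL(a))=\varphi(v,a^p,t)$ for $0<t<1$. 4. There are an $\mathbb R^o$-tree $Y$ and a (well-defined) injective map $\psi:T(BF(o))\to Y$ preserving distances, where $\mathbb Z^o\subset\mathbb R^o$. Moreover, for each $w\in BF(o)$ there is a geodesic $\alpha:[0,L(w)]_{\mathbb R^o}\to Y$ from $\psi(1)$ to $\psi(w)$ such that, whenever $w=va^p$ with $v$ not ending in $a^{-p}$, $\alpha(L(v))=\psi(v)$ and $\alpha(L(v)+n)=\psi(\langle L(v)+n,w\rangle)$ for all $n\in[0,L(a)]_{\mathbb Z^o}$. 5. If $v$ does not end in $a^{-p}$, the subsets $\{L(v)+tL(a):t\in[0,1]\}$ and $\{L(v)+n:n\in[0,L(a)]_{\mathbb Z^o}\}$ of $\mathbb R^o$ have only the endpoints $L(v)$ and $L(va^p)$ in common. -/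

import Mathlib

open Set

universe u

/-! ### Transfinite words -/

/-- Letters of `A ∪ A⁻¹`: `(a, true)` is `a` and `(a, false)` is the formal inverse of `a`. -/
abbrev Letter (A : Type u) : Type u := A × Bool

/-- The formal inverse of a letter. -/
def Letter.inv {A : Type u} (x : Letter A) : Letter A := (x.1, !x.2)

theorem Letter.inv_inv {A : Type u} (x : Letter A) : x.inv.inv = x := by
  simp [Letter.inv]

/-- A transfinite word: a map from a totally ordered set to `A ∪ A⁻¹` with finite fibres. (As the
fibres are finite, every totally ordered set carrying a word over `A` is isomorphic to one in the
universe of `A`.) -/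
structure TransfiniteWord (A : Type u) : Type (u + 1) where
  /-- the index set of the word -/
  carrier : Type u
  /-- the total order of the index set -/
  order : LinearOrder carrier
  /-- the letters of the word -/
  letter : carrier → Letter A
  finite_fiber : ∀ x : Letter A, {s | letter s = x}.Finite

namespace TransfiniteWord

instance {A : Type u} (w : TransfiniteWord A) : LinearOrder w.carrier := w.order

/-- A cancellation of a transfinite word: an involution `t ↦ t*` of a subset `T` of the index set
which is complete, noncrossing, and an inverse pairing. (The values of `star` off `support = T`
play no role.) -/
structure Cancellation {A : Type u} (w : TransfiniteWord A) where
  /-- the set of cancelled indices -/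
  support : Set w.carrier
  /-- the pairing -/
  star : w.carrier → w.carrier
  star_mem : ∀ t ∈ support, star t ∈ support
  star_star : ∀ t ∈ support, star (star t) = t
  complete : ∀ t ∈ support, Icc t (star t) ⊆ support
  noncrossing : ∀ t ∈ support, star '' Icc t (star t) = Icc t (star t)
  letter_star : ∀ t ∈ support, w.letter (star t) = (w.letter t).inv

/-- A word is reduced if it admits no nonempty cancellation. -/
def IsReduced {A : Type u} (w : TransfiniteWord A) : Prop :=
  ∀ c : w.Cancellation, c.support = ∅

/-- `w.CancelsTo v`: up to an order isomorphism respecting the letters (the order embedding `f`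
onto the complement of the support), `v` is the restriction of `w` that arises from some
cancellation. The empty cancellation is allowed, so isomorphic words are related. -/
def CancelsTo {A : Type u} (w v : TransfiniteWord A) : Prop :=
  ∃ (c : w.Cancellation) (f : v.carrier ↪o w.carrier),
    range f = c.supportᶜ ∧ ∀ s, w.letter (f s) = v.letter s

/-- The empty word. -/
def empty (A : Type u) : TransfiniteWord A where
  carrier := PEmpty
  order := inferInstance
  letter := fun s => s.elim
  finite_fiber := fun _ => Set.toFinite _

/-- The word consisting of one letter. -/
def single {A : Type u} (x : Letter A) : TransfiniteWord A where
  carrier := PUnit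
  order := inferInstance
  letter := fun _ => x
  finite_fiber := fun _ => Set.toFinite _

/-- Concatenation, indexed by the ordered disjoint union of the index sets. -/
def concat {A : Type u} (w v : TransfiniteWord A) : TransfiniteWord A where
  carrier := w.carrier ⊕ₗ v.carrier
  order := inferInstance
  letter := fun s => Sum.elim w.letter v.letter (ofLex s)
  finite_fiber := fun x => by
    refine (((w.finite_fiber x).image (fun s => toLex (Sum.inl s))).union
      ((v.finite_fiber x).image (fun s => toLex (Sum.inr s)))).subset ?_
    intro s hs
    rcases s with s | s
    · exact Or.inl ⟨s, hs, rfl⟩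
    · exact Or.inr ⟨s, hs, rfl⟩

/-- The inverse word: reverse the order and invert every letter. -/
def inverse {A : Type u} (w : TransfiniteWord A) : TransfiniteWord A where
  carrier := w.carrierᵒᵈ
  order := inferInstance
  letter := fun s => (w.letter (OrderDual.ofDual s)).inv
  finite_fiber := fun x => by
    refine (w.finite_fiber x.inv).subset ?_
    intro s hs
    have hs' : (w.letter (OrderDual.ofDual s)).inv = x := hs
    change w.letter (OrderDual.ofDual s) = x.inv
    rw [← hs', Letter.inv_inv]

/-- The restriction of a word to a subset of its index set. -/
def restrict {A : Type u} (w : TransfiniteWord A) (S : Set w.carrier) : TransfiniteWord A where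
  carrier := S
  order := inferInstance
  letter := fun s => w.letter s.1
  finite_fiber := fun x =>
    (w.finite_fiber x).preimage (f := fun s : S => s.1) Subtype.val_injective.injOn

/-! Facts needed for the group structure and for the existence of reduced forms. -/

theorem image_star_eq {α : Type u} {T I : Set α} {f : α → α} (hI : I ⊆ T)
    (hinv : ∀ t ∈ T, f (f t) = t) (hmap : ∀ t ∈ I, f t ∈ I) : f '' I = I := by
  apply Subset.antisymm
  · rintro _ ⟨t, ht, rfl⟩
    exact hmap t ht
  · intro t ht
    exact ⟨f t, hmap t ht, hinv t (hI ht)⟩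

theorem Cancellation.star_mem_Icc {A : Type u} {w : TransfiniteWord A} (c : w.Cancellation)
    {t r : w.carrier} (ht : t ∈ c.support) (hr : r ∈ Icc t (c.star t)) :
    c.star r ∈ Icc t (c.star t) := by
  rw [← c.noncrossing t ht]
  exact mem_image_of_mem _ hr

/-- The empty cancellation. -/
def Cancellation.nil {A : Type u} (w : TransfiniteWord A) : w.Cancellation where
  support := ∅
  star := id
  star_mem := by simp
  star_star := by simp
  complete := by simp
  noncrossing := by simp
  letter_star := by simp

theorem cancelsTo_of_orderIso {A : Type u} {w v : TransfiniteWord A}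
    (e : v.carrier ≃o w.carrier) (h : ∀ s, w.letter (e s) = v.letter s) : w.CancelsTo v :=
  ⟨Cancellation.nil w, e.toOrderEmbedding, by
    simp [Cancellation.nil], h⟩

theorem concat_cancelsTo_left {A : Type u} {w w' : TransfiniteWord A} (v : TransfiniteWord A)
    (h : w.CancelsTo w') : (w.concat v).CancelsTo (w'.concat v) := by
  obtain ⟨c, f, hf, hl⟩ := h
  refine ⟨⟨{s | ∃ t ∈ c.support, toLex (Sum.inl t) = s},
    fun s => toLex (Sum.map c.star id (ofLex s)), ?_, ?_, ?_, ?_, ?_⟩,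
    OrderEmbedding.ofStrictMono (fun s => toLex (Sum.map f id (ofLex s))) ?_, ?_, ?_⟩
  · rintro _ ⟨t, ht, rfl⟩
    exact ⟨_, c.star_mem t ht, rfl⟩
  · rintro _ ⟨t, ht, rfl⟩
    change toLex (Sum.inl (c.star (c.star t))) = _
    rw [c.star_star t ht]
  · rintro _ ⟨t, ht, rfl⟩ s ⟨h1, h2⟩
    rcases s with s | s
    · exact ⟨s, c.complete t ht ⟨Sum.Lex.inl_le_inl_iff.1 h1, Sum.Lex.inl_le_inl_iff.1 h2⟩, rfl⟩
    · exact absurd h2 Sum.Lex.not_inr_le_inl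
  · rintro _ ⟨t, ht, rfl⟩
    have key : ∀ s ∈ Icc (toLex (Sum.inl t) : w.carrier ⊕ₗ v.carrier)
        (toLex (Sum.inl (c.star t))), ∃ r ∈ Icc t (c.star t), toLex (Sum.inl r) = s := by
      rintro s ⟨h1, h2⟩
      rcases s with s | s
      · exact ⟨s, ⟨Sum.Lex.inl_le_inl_iff.1 h1, Sum.Lex.inl_le_inl_iff.1 h2⟩, rfl⟩
      · exact absurd h2 Sum.Lex.not_inr_le_inl
    refine image_star_eq (T := {s | ∃ t ∈ c.support, toLex (Sum.inl t) = s}) ?_ ?_ ?_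
    · intro s hs
      obtain ⟨r, hr, rfl⟩ := key s hs
      exact ⟨r, c.complete t ht hr, rfl⟩
    · rintro _ ⟨t, ht, rfl⟩
      change toLex (Sum.inl (c.star (c.star t))) = _
      rw [c.star_star t ht]
    · intro s hs
      obtain ⟨r, hr, rfl⟩ := key s hs
      have := c.star_mem_Icc ht hr
      exact ⟨Sum.Lex.inl_le_inl_iff.2 this.1, Sum.Lex.inl_le_inl_iff.2 this.2⟩
  · rintro _ ⟨t, ht, rfl⟩
    exact c.letter_star t ht
  · intro s t hst
    rcases s with s | s <;> rcases t with t | t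
    · exact Sum.Lex.inl_lt_inl_iff.2 (f.strictMono (Sum.Lex.inl_lt_inl_iff.1 hst))
    · exact Sum.Lex.inl_lt_inr _ _
    · exact absurd hst Sum.Lex.not_inr_lt_inl
    · exact Sum.Lex.inr_lt_inr_iff.2 (Sum.Lex.inr_lt_inr_iff.1 hst)
  · ext s
    rcases s with s | s
    · have h1 : s ∈ range f ↔ s ∈ c.supportᶜ := by rw [hf]
      constructor
      · rintro ⟨r, hr⟩ ⟨t, ht, hts⟩
        rcases r with r | r
        · have e1 : f r = s := Sum.inl_injective hr
          have e2 : t = s := Sum.inl_injective hts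
          exact h1.1 ⟨r, e1⟩ (e2 ▸ ht)
        · exact absurd hr (by intro h; cases h)
      · intro hs
        obtain ⟨r, hr⟩ := h1.2 (fun h => hs ⟨s, h, rfl⟩)
        exact ⟨toLex (Sum.inl r), congrArg (fun z => toLex (Sum.inl z)) hr⟩
    · constructor
      · rintro _ ⟨t, ht, hts⟩
        exact absurd hts (by intro h; cases h)
      · intro _
        exact ⟨toLex (Sum.inr s), rfl⟩
  · intro s
    rcases s with s | s
    · exact hl s
    · rfl

theorem concat_cancelsTo_right {A : Type u} {v v' : TransfiniteWord A} (w : TransfiniteWord A)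
    (h : v.CancelsTo v') : (w.concat v).CancelsTo (w.concat v') := by
  obtain ⟨c, f, hf, hl⟩ := h
  refine ⟨⟨{s | ∃ t ∈ c.support, toLex (Sum.inr t) = s},
    fun s => toLex (Sum.map id c.star (ofLex s)), ?_, ?_, ?_, ?_, ?_⟩,
    OrderEmbedding.ofStrictMono (fun s => toLex (Sum.map id f (ofLex s))) ?_, ?_, ?_⟩
  · rintro _ ⟨t, ht, rfl⟩
    exact ⟨_, c.star_mem t ht, rfl⟩
  · rintro _ ⟨t, ht, rfl⟩
    change toLex (Sum.inr (c.star (c.star t))) = _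
    rw [c.star_star t ht]
  · rintro _ ⟨t, ht, rfl⟩ s ⟨h1, h2⟩
    rcases s with s | s
    · exact absurd h1 Sum.Lex.not_inr_le_inl
    · exact ⟨s, c.complete t ht ⟨Sum.Lex.inr_le_inr_iff.1 h1, Sum.Lex.inr_le_inr_iff.1 h2⟩, rfl⟩
  · rintro _ ⟨t, ht, rfl⟩
    have key : ∀ s ∈ Icc (toLex (Sum.inr t) : w.carrier ⊕ₗ v.carrier)
        (toLex (Sum.inr (c.star t))), ∃ r ∈ Icc t (c.star t), toLex (Sum.inr r) = s := by
      rintro s ⟨h1, h2⟩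
      rcases s with s | s
      · exact absurd h1 Sum.Lex.not_inr_le_inl
      · exact ⟨s, ⟨Sum.Lex.inr_le_inr_iff.1 h1, Sum.Lex.inr_le_inr_iff.1 h2⟩, rfl⟩
    refine image_star_eq (T := {s | ∃ t ∈ c.support, toLex (Sum.inr t) = s}) ?_ ?_ ?_
    · intro s hs
      obtain ⟨r, hr, rfl⟩ := key s hs
      exact ⟨r, c.complete t ht hr, rfl⟩
    · rintro _ ⟨t, ht, rfl⟩
      change toLex (Sum.inr (c.star (c.star t))) = _
      rw [c.star_star t ht]
    · intro s hs
      obtain ⟨r, hr, rfl⟩ := key s hs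
      have := c.star_mem_Icc ht hr
      exact ⟨Sum.Lex.inr_le_inr_iff.2 this.1, Sum.Lex.inr_le_inr_iff.2 this.2⟩
  · rintro _ ⟨t, ht, rfl⟩
    exact c.letter_star t ht
  · intro s t hst
    rcases s with s | s <;> rcases t with t | t
    · exact Sum.Lex.inl_lt_inl_iff.2 (Sum.Lex.inl_lt_inl_iff.1 hst)
    · exact Sum.Lex.inl_lt_inr _ _
    · exact absurd hst Sum.Lex.not_inr_lt_inl
    · exact Sum.Lex.inr_lt_inr_iff.2 (f.strictMono (Sum.Lex.inr_lt_inr_iff.1 hst))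
  · ext s
    rcases s with s | s
    · constructor
      · rintro _ ⟨t, ht, hts⟩
        exact absurd hts (by intro h; cases h)
      · intro _
        exact ⟨toLex (Sum.inl s), rfl⟩
    · have h1 : s ∈ range f ↔ s ∈ c.supportᶜ := by rw [hf]
      constructor
      · rintro ⟨r, hr⟩ ⟨t, ht, hts⟩
        rcases r with r | r
        · exact absurd hr (by intro h; cases h)
        · have e1 : f r = s := Sum.inr_injective hr
          have e2 : t = s := Sum.inr_injective hts
          exact h1.1 ⟨r, e1⟩ (e2 ▸ ht)
      · intro hs
        obtain ⟨r, hr⟩ := h1.2 (fun h => hs ⟨s, h, rfl⟩)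
        exact ⟨toLex (Sum.inr r), congrArg (fun z => toLex (Sum.inr z)) hr⟩
  · intro s
    rcases s with s | s
    · rfl
    · exact hl s

theorem inverse_cancelsTo {A : Type u} {w w' : TransfiniteWord A}
    (h : w.CancelsTo w') : w.inverse.CancelsTo w'.inverse := by
  obtain ⟨c, f, hf, hl⟩ := h
  have key : ∀ t ∈ c.support, ∀ r, c.star t ≤ r → r ≤ t →
      r ∈ c.support ∧ c.star t ≤ c.star r ∧ c.star r ≤ t := by
    intro t ht r h1 h2
    have hs := c.star_mem t ht
    have e := c.star_star t ht
    have hr : r ∈ Icc (c.star t) (c.star (c.star t)) := ⟨h1, by rw [e]; exact h2⟩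
    have h3 := c.star_mem_Icc hs hr
    rw [e] at h3
    exact ⟨c.complete _ hs hr, h3.1, h3.2⟩
  refine ⟨⟨{s : w.carrierᵒᵈ | OrderDual.ofDual s ∈ c.support},
    fun s => OrderDual.toDual (c.star (OrderDual.ofDual s)), ?_, ?_, ?_, ?_, ?_⟩,
    f.dual, ?_, ?_⟩
  · intro t ht
    exact c.star_mem _ ht
  · intro t ht
    exact c.star_star _ ht
  · intro t ht r hr
    exact (key _ ht _ hr.2 hr.1).1
  · intro t ht
    refine image_star_eq (T := {s : w.carrierᵒᵈ | OrderDual.ofDual s ∈ c.support}) ?_ ?_ ?_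
    · intro r hr
      exact (key _ ht _ hr.2 hr.1).1
    · intro t ht
      exact c.star_star _ ht
    · intro r hr
      have := (key _ ht _ hr.2 hr.1).2
      exact ⟨this.2, this.1⟩
  · intro t ht
    exact congrArg Letter.inv (c.letter_star _ ht)
  · exact hf
  · intro s
    exact congrArg Letter.inv (hl _)

theorem inverse_concat_self_cancelsTo {A : Type u} (w : TransfiniteWord A) :
    (w.inverse.concat w).CancelsTo (empty A) := by
  let f : w.carrierᵒᵈ ⊕ₗ w.carrier → w.carrierᵒᵈ ⊕ₗ w.carrier := fun s =>
    Sum.elim (fun a => toLex (Sum.inr (OrderDual.ofDual a)))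
      (fun a => toLex (Sum.inl (OrderDual.toDual a))) (ofLex s)
  have hinv : ∀ s, f (f s) = s := by
    intro s
    rcases s with s | s <;> rfl
  refine ⟨⟨univ, f, fun _ _ => mem_univ _, fun s _ => hinv s, fun _ _ => subset_univ _, ?_, ?_⟩,
    OrderEmbedding.ofStrictMono (fun s => s.elim) (fun s => s.elim), ?_, fun s => s.elim⟩
  · intro t _
    refine image_star_eq (T := univ) (subset_univ _) (fun s _ => hinv s) ?_
    intro r hr
    rcases t with t | t
    · rcases r with r | r
      · have h1 := Sum.Lex.inl_le_inl_iff.1 hr.1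
        exact ⟨Sum.Lex.inl_le_inr _ _, Sum.Lex.inr_le_inr_iff.2 h1⟩
      · have h1 := Sum.Lex.inr_le_inr_iff.1 hr.2
        exact ⟨Sum.Lex.inl_le_inl_iff.2 h1, Sum.Lex.inl_le_inr _ _⟩
    · exact absurd (hr.1.trans hr.2) Sum.Lex.not_inr_le_inl
  · intro t _
    rcases t with t | t
    · exact (Letter.inv_inv _).symm
    · rfl
  · ext s
    simp only [mem_range, compl_univ, mem_empty_iff_false, iff_false]
    rintro ⟨t, -⟩
    exact t.elim

theorem restrict_cancelsTo {A : Type u} {w : TransfiniteWord A} (c : w.Cancellation) :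
    w.CancelsTo (w.restrict c.supportᶜ) :=
  ⟨c, OrderEmbedding.subtype _, Subtype.range_coe, fun _ => rfl⟩

/-- A cancellation `c` followed by a cancellation of the resulting word is a cancellation. -/
theorem Cancellation.exists_comp {A : Type u} {w : TransfiniteWord A} (c : w.Cancellation)
    (d : (w.restrict c.supportᶜ).Cancellation) :
    ∃ e : w.Cancellation, e.support = c.support ∪ Subtype.val '' d.support ∧
      ∀ t ∈ c.support, e.star t = c.star t := by
  classical
  let f : w.carrier → w.carrier := fun t =>
    if h : t ∈ c.support then c.star t else (d.star ⟨t, h⟩).1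
  have f1 : ∀ t ∈ c.support, f t = c.star t := fun t ht => dif_pos ht
  have f2 : ∀ t : (w.restrict c.supportᶜ).carrier, f t.1 = (d.star t).1 :=
    fun t => dif_neg t.2
  have hinv : ∀ t ∈ c.support ∪ Subtype.val '' d.support, f (f t) = t := by
    rintro t (ht | ⟨t, ht, rfl⟩)
    · rw [f1 t ht, f1 _ (c.star_mem t ht), c.star_star t ht]
    · rw [f2 t, f2 (d.star t), d.star_star t ht]
  -- an interval spanned by a pair of `d` is stable under both pairings
  have key : ∀ t ∈ d.support, ∀ r ∈ Icc t.1 (d.star t).1,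
      r ∈ c.support ∪ Subtype.val '' d.support ∧ f r ∈ Icc t.1 (d.star t).1 := by
    intro t ht r hr
    by_cases hc : r ∈ c.support
    · refine ⟨Or.inl hc, ?_⟩
      rw [f1 r hc]
      have hsc := c.star_mem r hc
      constructor
      · by_contra hlt
        rw [not_le] at hlt
        refine t.2 (c.complete _ hsc ⟨hlt.le, ?_⟩)
        rw [c.star_star r hc]
        exact hr.1
      · by_contra hlt
        rw [not_le] at hlt
        exact (d.star t).2 (c.complete _ hc ⟨hr.2, hlt.le⟩)
    · have hm : (⟨r, hc⟩ : (w.restrict c.supportᶜ).carrier) ∈ Icc t (d.star t) := hr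
      have h2 : f r = (d.star ⟨r, hc⟩).1 := f2 ⟨r, hc⟩
      refine ⟨Or.inr ⟨⟨r, hc⟩, d.complete t ht hm, rfl⟩, ?_⟩
      rw [h2]
      exact d.star_mem_Icc ht hm
  have key' : ∀ t ∈ c.support ∪ Subtype.val '' d.support, ∀ r ∈ Icc t (f t),
      r ∈ c.support ∪ Subtype.val '' d.support ∧ f r ∈ Icc t (f t) := by
    rintro t (ht | ⟨t, ht, rfl⟩) r hr
    · rw [f1 t ht] at hr ⊢
      have hc := c.complete t ht hr
      rw [f1 r hc]
      exact ⟨Or.inl hc, c.star_mem_Icc ht hr⟩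
    · rw [f2 t] at hr ⊢
      exact key t ht r hr
  refine ⟨⟨c.support ∪ Subtype.val '' d.support, f, ?_, hinv, fun t ht r hr => (key' t ht r hr).1,
    ?_, ?_⟩, rfl, f1⟩
  · rintro t (ht | ⟨t, ht, rfl⟩)
    · rw [f1 t ht]
      exact Or.inl (c.star_mem t ht)
    · rw [f2 t]
      exact Or.inr ⟨_, d.star_mem t ht, rfl⟩
  · intro t ht
    exact image_star_eq (fun r hr => (key' t ht r hr).1) hinv (fun r hr => (key' t ht r hr).2)
  · rintro t (ht | ⟨t, ht, rfl⟩)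
    · rw [f1 t ht]
      exact c.letter_star t ht
    · rw [f2 t]
      exact d.letter_star t ht

theorem exists_reduced {A : Type u} (w : TransfiniteWord A) :
    ∃ v : TransfiniteWord A, v.IsReduced ∧ w.CancelsTo v := by
  classical
  let R : w.Cancellation → w.Cancellation → Prop := fun c d =>
    c.support ⊆ d.support ∧ ∀ t ∈ c.support, d.star t = c.star t
  have htrans : ∀ {a b c : w.Cancellation}, R a b → R b c → R a c := by
    intro a b c hab hbc
    exact ⟨hab.1.trans hbc.1, fun t ht => (hbc.2 t (hab.1 ht)).trans (hab.2 t ht)⟩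
  obtain ⟨m, hm⟩ : ∃ m : w.Cancellation, ∀ a, R m a → R a m := by
    refine exists_maximal_of_chains_bounded ?_ htrans
    intro C hC
    have agree : ∀ a ∈ C, ∀ b ∈ C, ∀ t ∈ a.support, t ∈ b.support → a.star t = b.star t := by
      intro a ha b hb t hta htb
      by_cases hab : a = b
      · rw [hab]
      · rcases hC ha hb hab with h | h
        · exact (h.2 t hta).symm
        · exact h.2 t htb
    let f : w.carrier → w.carrier := fun t =>
      if h : ∃ c ∈ C, t ∈ c.support then h.choose.star t else t
    have hf : ∀ c ∈ C, ∀ t ∈ c.support, f t = c.star t := by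
      intro c hc t ht
      have h : ∃ c ∈ C, t ∈ c.support := ⟨c, hc, ht⟩
      have e : f t = h.choose.star t := dif_pos h
      rw [e]
      exact agree _ h.choose_spec.1 _ hc _ h.choose_spec.2 ht
    refine ⟨⟨{t | ∃ c ∈ C, t ∈ c.support}, f, ?_, ?_, ?_, ?_, ?_⟩, ?_⟩
    · rintro t ⟨c, hc, ht⟩
      exact ⟨c, hc, by rw [hf c hc t ht]; exact c.star_mem t ht⟩
    · rintro t ⟨c, hc, ht⟩
      rw [hf c hc t ht, hf c hc _ (c.star_mem t ht), c.star_star t ht]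
    · rintro t ⟨c, hc, ht⟩ r hr
      rw [hf c hc t ht] at hr
      exact ⟨c, hc, c.complete t ht hr⟩
    · rintro t ⟨c, hc, ht⟩
      rw [hf c hc t ht]
      refine image_star_eq (T := c.support) (c.complete t ht) ?_ ?_
      · intro r hr
        rw [hf c hc r hr, hf c hc _ (c.star_mem r hr), c.star_star r hr]
      · intro r hr
        rw [hf c hc r (c.complete t ht hr)]
        exact c.star_mem_Icc ht hr
    · rintro t ⟨c, hc, ht⟩
      rw [hf c hc t ht]
      exact c.letter_star t ht
    · intro a ha
      exact ⟨fun t ht => ⟨a, ha, ht⟩, hf a ha⟩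
  refine ⟨w.restrict m.supportᶜ, ?_, restrict_cancelsTo m⟩
  intro d
  obtain ⟨e, he1, he2⟩ := m.exists_comp d
  have hme : R m e := ⟨he1 ▸ subset_union_left, he2⟩
  have hem := (hm e hme).1
  rw [eq_empty_iff_forall_notMem]
  intro t ht
  exact t.2 (hem (he1 ▸ Or.inr ⟨t, ht, rfl⟩))

end TransfiniteWord

/-! ### The big free group -/

/-- The big free group on the alphabet `A`: transfinite words modulo the equivalence relation
generated by cancellation. -/
def BigFreeGroup (A : Type u) : Type (u + 1) :=
  Quot (TransfiniteWord.CancelsTo (A := A))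

namespace BigFreeGroup

/-- The class of a transfinite word. -/
def mk {A : Type u} (w : TransfiniteWord A) : BigFreeGroup A := Quot.mk _ w

instance {A : Type u} : Mul (BigFreeGroup A) :=
  ⟨Quot.map₂ TransfiniteWord.concat (fun w _ _ h => TransfiniteWord.concat_cancelsTo_right w h)
    (fun _ _ v h => TransfiniteWord.concat_cancelsTo_left v h)⟩

instance {A : Type u} : One (BigFreeGroup A) := ⟨mk (TransfiniteWord.empty A)⟩

instance {A : Type u} : Inv (BigFreeGroup A) :=
  ⟨Quot.map TransfiniteWord.inverse (fun _ _ h => TransfiniteWord.inverse_cancelsTo h)⟩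

instance {A : Type u} : Group (BigFreeGroup A) :=
  Group.ofLeftAxioms
    (by
      rintro ⟨w⟩ ⟨v⟩ ⟨z⟩
      refine (Quot.sound (TransfiniteWord.cancelsTo_of_orderIso
        (w := w.concat (v.concat z)) (v := (w.concat v).concat z)
        (OrderIso.sumLexAssoc w.carrier v.carrier z.carrier) ?_)).symm
      intro s
      rcases s with (s | s) | s <;> rfl)
    (by
      rintro ⟨w⟩
      refine (Quot.sound (TransfiniteWord.cancelsTo_of_orderIso
        (w := w) (v := (TransfiniteWord.empty A).concat w)
        (OrderIso.emptySumLex (α := w.carrier) (β := PEmpty)) ?_)).symm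
      intro s
      rcases s with s | s
      · exact s.elim
      · rfl)
    (by
      rintro ⟨w⟩
      exact Quot.sound (TransfiniteWord.inverse_concat_self_cancelsTo w))

/-- The element of the big free group given by a single letter. -/
def ofLetter {A : Type u} (x : Letter A) : BigFreeGroup A := mk (TransfiniteWord.single x)

theorem exists_reduced_rep {A : Type u} (g : BigFreeGroup A) :
    ∃ r : TransfiniteWord A, r.IsReduced ∧ mk r = g := by
  obtain ⟨w⟩ := g
  obtain ⟨r, hr, h⟩ := w.exists_reduced
  exact ⟨r, hr, (Quot.sound h).symm⟩

/-- The reduced word representing an element of the big free group. -/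
noncomputable def reducedForm {A : Type u} (g : BigFreeGroup A) : TransfiniteWord A :=
  g.exists_reduced_rep.choose

/-- The reduced word representing `g` has a last letter, and that letter is `x`. -/
def EndsIn {A : Type u} (g : BigFreeGroup A) (x : Letter A) : Prop :=
  ∃ s : g.reducedForm.carrier, (∀ r, r ≤ s) ∧ g.reducedForm.letter s = x

end BigFreeGroup

/-! ### Metric spaces over an ordered abelian group -/

/-- `Λ`-metrics. -/
structure IsLambdaMetric {Λ : Type*} [AddCommGroup Λ] [LinearOrder Λ] {X : Type*}
    (d : X → X → Λ) : Prop where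
  nonneg : ∀ x y, 0 ≤ d x y
  eq_zero_iff : ∀ x y, d x y = 0 ↔ x = y
  symm : ∀ x y, d x y = d y x
  triangle : ∀ x y z, d x y ≤ d x z + d z y

/-- The Gromov product of `x` and `y` with respect to the basepoint `v`. -/
noncomputable def gromovProduct {Λ : Type*} [AddCommGroup Λ] [Module ℝ Λ] {X : Type*}
    (d : X → X → Λ) (v x y : X) : Λ :=
  (1 / 2 : ℝ) • (d v x + d v y - d x y)

/-- `δ`-hyperbolicity (with respect to every basepoint). -/
def IsLambdaHyperbolic {Λ : Type*} [AddCommGroup Λ] [LinearOrder Λ] [Module ℝ Λ] {X : Type*}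
    (d : X → X → Λ) (δ : Λ) : Prop :=
  ∀ v x y z, min (gromovProduct d v x z) (gromovProduct d v y z) - δ ≤ gromovProduct d v x y

/-- `α` restricts to an isometry of the interval `[a, b]` of `Λ`, with its metric `|s - t|`,
into `X`. -/
def IsGeodesicOn {Λ : Type*} [AddCommGroup Λ] [LinearOrder Λ] {X : Type*}
    (d : X → X → Λ) (a b : Λ) (α : Λ → X) : Prop :=
  ∀ s ∈ Icc a b, ∀ t ∈ Icc a b, d (α s) (α t) = |s - t|

/-- `S` is a segment with endpoints `x` and `y`: the image of a geodesic from `x` to `y`. -/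
def IsSegment {Λ : Type*} [AddCommGroup Λ] [LinearOrder Λ] {X : Type*}
    (d : X → X → Λ) (S : Set X) (x y : X) : Prop :=
  ∃ (a b : Λ) (α : Λ → X), a ≤ b ∧ IsGeodesicOn d a b α ∧ α a = x ∧ α b = y ∧ α '' Icc a b = S

/-- `Λ`-trees. -/
structure IsLambdaTree {Λ : Type*} [AddCommGroup Λ] [LinearOrder Λ] {X : Type*}
    (d : X → X → Λ) : Prop where
  metric : IsLambdaMetric d
  geodesic : ∀ x y, ∃ S, IsSegment d S x y
  union_segment : ∀ S T x y z, IsSegment d S x y → IsSegment d T y z → S ∩ T = {y} →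
    ∃ p q, IsSegment d (S ∪ T) p q
  inter_segment : ∀ S T x y z, IsSegment d S x y → IsSegment d T x z →
    ∃ p q, IsSegment d (S ∩ T) p q

/-! ### Lengths in `ℤ^o` and `ℝ^o` -/

/-- `ℤ^o` with the lexicographic order, where `A` is well ordered of order type `o`. -/
abbrev IntPow (A : Type u) : Type u := Lex (A → ℤ)

/-- `ℝ^o` with the lexicographic order, where `A` is well ordered of order type `o`. -/
abbrev RealPow (A : Type u) : Type u := Lex (A → ℝ)

/-- The inclusion of `ℤ^o` in `ℝ^o`. -/
def IntPow.toReal {A : Type u} (n : IntPow A) : RealPow A := toLex fun a => ((ofLex n a : ℤ) : ℝ)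

namespace BigFreeGroup

/-- `L(g) ∈ ℤ^o`: for each `a`, the number of occurrences of `a` and `a⁻¹` in the reduced form. -/
noncomputable def lengthZ {A : Type u} (g : BigFreeGroup A) : IntPow A :=
  toLex fun a => (({s | (g.reducedForm.letter s).1 = a}.ncard : ℕ) : ℤ)

theorem lengthZ_nonneg {A : Type u} [LinearOrder A] [WellFoundedLT A] (g : BigFreeGroup A) :
    0 ≤ g.lengthZ := by
  have h : (0 : A → ℤ) ≤ ofLex g.lengthZ := fun _ => Int.natCast_nonneg _
  exact Pi.toLex_monotone h

/-- `L(g)` viewed in `ℝ^o`. -/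
noncomputable def length {A : Type u} (g : BigFreeGroup A) : RealPow A := g.lengthZ.toReal

/-- `c(g, h) = (L(g) + L(h) - L(g⁻¹ h)) / 2`. -/
noncomputable def overlap {A : Type u} (g h : BigFreeGroup A) : RealPow A :=
  (1 / 2 : ℝ) • (g.length + h.length - (g⁻¹ * h).length)

end BigFreeGroup

/-! ### The big Cayley graph -/

/-- Symbols for points: `vertex w` stands for `w`, and `edge w x t` for the triple `(w, x, t)` with
`x = a^p` a letter. -/
inductive CayleySymbol (A : Type u) : Type (u + 1) where
  | vertex (w : BigFreeGroup A) : CayleySymbol A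
  | edge (w : BigFreeGroup A) (x : Letter A) (t : ℝ) : CayleySymbol A

namespace CayleySymbol

/-- The symbols which represent points: in `(w, x, t)` one has `0 < t < 1`, and `w` does not end
in `x⁻¹`. -/
def IsPoint {A : Type u} : CayleySymbol A → Prop
  | vertex _ => True
  | edge w x t => 0 < t ∧ t < 1 ∧ ¬ w.EndsIn x.inv

open scoped Classical in
/-- The formula for the action of the big free group. -/
noncomputable def act {A : Type u} (g : BigFreeGroup A) : CayleySymbol A → CayleySymbol A
  | vertex w => vertex (g * w)
  | edge w x t =>
      if (g * w).EndsIn x.inv then edge (g * w * BigFreeGroup.ofLetter x) x.inv (1 - t)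
      else edge (g * w) x t

/-- `L(w) + t L(a)`, with `t = 0` at a vertex `w`. -/
noncomputable def height {A : Type u} : CayleySymbol A → RealPow A
  | vertex w => w.length
  | edge w x t => w.length + t • (BigFreeGroup.ofLetter x).length

/-- The word `w a^p` at the end of the edge `(w, a^p, ·)`; at a vertex `w`, the word `w`. -/
def endWord {A : Type u} : CayleySymbol A → BigFreeGroup A
  | vertex w => w
  | edge w x _ => w * BigFreeGroup.ofLetter x

end CayleySymbol

/-- The big Cayley graph `Γ(BF(o))`, each point given by its unique representation. -/
def BigCayleyGraph (A : Type u) : Type (u + 1) := {P : CayleySymbol A // P.IsPoint}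

namespace BigCayleyGraph

/-- The vertex given by an element of the big free group. -/
def vertex {A : Type u} (w : BigFreeGroup A) : BigCayleyGraph A :=
  ⟨CayleySymbol.vertex w, trivial⟩

/-- The point `(w, x, t)`. -/
def edge {A : Type u} (w : BigFreeGroup A) (x : Letter A) (t : ℝ) (ht : t ∈ Ioo (0 : ℝ) 1)
    (hw : ¬ w.EndsIn x.inv) : BigCayleyGraph A :=
  ⟨CayleySymbol.edge w x t, ht.1, ht.2, hw⟩

/-- The `ℝ^o`-valued distance on the big Cayley graph. -/
noncomputable def bigDist {A : Type u} [LinearOrder A] [WellFoundedLT A]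
    (P Q : BigCayleyGraph A) : RealPow A :=
  P.1.height + Q.1.height -
    2 • min P.1.height (min Q.1.height (P.1.endWord.overlap Q.1.endWord))

end BigCayleyGraph

/-! ### The `ℤ^o`-tree of the big free group -/

/-- A point `n` of the interval `[0, L(g)]` of `ℤ^o`. -/
structure IntervalPoint (A : Type u) [LinearOrder A] [WellFoundedLT A] : Type (u + 1) where
  /-- the group element -/
  word : BigFreeGroup A
  /-- the point of the interval -/
  val : IntPow A
  mem : val ∈ Icc 0 word.lengthZ

namespace IntervalPoint

/-- `n ∈ [0, L(g)]` and `n ∈ [0, L(h)]` are identified if `n ≤ c(g, h)`. -/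
def Identified {A : Type u} [LinearOrder A] [WellFoundedLT A] (p q : IntervalPoint A) : Prop :=
  p.val = q.val ∧ p.val.toReal ≤ p.word.overlap q.word

/-- `n + m - 2 min {n, m, c(g, h)}`, viewed in `ℝ^o`. -/
noncomputable def dist {A : Type u} [LinearOrder A] [WellFoundedLT A] (p q : IntervalPoint A) :
    RealPow A :=
  p.val.toReal + q.val.toReal - 2 • min p.val.toReal (min q.val.toReal (p.word.overlap q.word))

end IntervalPoint

/-- The `ℤ^o`-tree `T(BF(o))`. -/
def IntTree (A : Type u) [LinearOrder A] [WellFoundedLT A] : Type (u + 1) :=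
  Quot (IntervalPoint.Identified (A := A))

/-- The point `⟨n, g⟩` of the `ℤ^o`-tree. -/
def IntTree.mk {A : Type u} [LinearOrder A] [WellFoundedLT A] (p : IntervalPoint A) : IntTree A :=
  Quot.mk _ p

/-- The point `⟨L(g), g⟩` of the `ℤ^o`-tree, which is the image of `g`. -/
noncomputable def IntTree.ofWord {A : Type u} [LinearOrder A] [WellFoundedLT A]
    (g : BigFreeGroup A) : IntTree A :=
  IntTree.mk ⟨g, g.lengthZ, g.lengthZ_nonneg, le_rfl⟩

/-! Everything is embedded in one `ℝ^o`-tree: the tree spanned by the group `BF(o)` itself with the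
left invariant metric `d(g,h) = L(g⁻¹h)`. Its Gromov product at `1` is `c(g,h)`, so the distance
formulas of the Cayley graph and of the `ℤ^o`-tree are both the formula `r + s - 2 min {r, s, c}`
for two points at heights `r`, `s` on segments from `1`.

The combinatorial core is that `c(g,h)` is the length of the longest common initial segment of the
reduced words (`exists_wordLength_eq_overlap`, `wordLength_le_overlap`). Two initial segments of one
word are nested, so `d` is `0`-hyperbolic. The longest common initial segment exists because finite
fibres make matchings of initial segments unique (`Matching.unique`), and removing it leaves `w'`,
`v'` with `w'⁻¹v'` reduced (`Matching.isReduced`): a cancellation would extend the matching.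

Counting letters in reduced words requires confluence: complete cancellability is invariant under
cancellation (`CancelsTo.pairable_univ_iff`). For finitely many generators one removes innermost
pairs; compactness over finite sets of generators, again using finite fibres, gives the general case
(`pairable_of_finite`).

On the metric side, a point of the spanned tree is recorded by its distances from the points of `X`,
and the tree metric is the largest difference of two such functions. No completeness of `Λ` is
needed because the maximum is attained at an explicit point (`SpanTree.isGreatest_point`). A
geodesic `0`-hyperbolic space is a `Λ`-tree (`IsLambdaMetric.isLambdaTree`). Group translations act
on these functions, and the action axioms on the Cayley graph are pulled back along its injective
equivariant map to the tree. -/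

/-! ### Gromov products and `0`-hyperbolic spaces over an ordered group -/

section LambdaTree

/-- Of the three sums of the opposite values of an ultrametric on four points, no one is smaller
than both others. -/
theorem min_add_le_add_of_min_le {Λ : Type*} [AddCommGroup Λ] [LinearOrder Λ]
    [IsOrderedAddMonoid Λ] {a b c e f g : Λ} (h1 : min a c ≤ f) (h2 : min e b ≤ f)
    (h3 : min e a ≤ g) (h4 : min b c ≤ g) : min (a + b) (c + e) ≤ f + g := by
  grind

variable {Λ : Type*} [AddCommGroup Λ] {X : Type*} {d : X → X → Λ}

/-- Clearing the factor `1/2` lets the later inequalities be settled by linear arithmetic in the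
ordered group, with no compatibility between the order and the real scalars. -/
theorem gromovProduct_add_self [Module ℝ Λ] (d : X → X → Λ) (v x y : X) :
    gromovProduct d v x y + gromovProduct d v x y = d v x + d v y - d x y := by
  rw [gromovProduct, ← add_smul]
  norm_num

variable [LinearOrder Λ]

theorem IsLambdaMetric.dist_self (hd : IsLambdaMetric d) (x : X) : d x x = 0 :=
  (hd.eq_zero_iff x x).2 rfl

theorem gromovProduct_comm [Module ℝ Λ] (hd : IsLambdaMetric d) (v x y : X) :
    gromovProduct d v x y = gromovProduct d v y x := by
  rw [gromovProduct, gromovProduct, hd.symm x y, add_comm (d v x)]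

theorem isLambdaHyperbolic_zero_iff [Module ℝ Λ] :
    IsLambdaHyperbolic d 0 ↔
      ∀ v x y z, min (gromovProduct d v x z) (gromovProduct d v y z) ≤ gromovProduct d v x y := by
  simp [IsLambdaHyperbolic]

variable [IsOrderedAddMonoid Λ]

/-- A segment parametrised from one of its endpoints. -/
theorem IsSegment.exists_param {S : Set X} {x y : X} (h : IsSegment d S x y) :
    ∃ α : Λ → X, IsGeodesicOn d 0 (d x y) α ∧ α 0 = x ∧ α (d x y) = y ∧
      α '' Icc 0 (d x y) = S := by
  obtain ⟨a, b, α, hab, hα, rfl, rfl, rfl⟩ := h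
  have e : d (α a) (α b) = b - a := by
    rw [hα a ⟨le_rfl, hab⟩ b ⟨hab, le_rfl⟩]
    grind
  rw [e]
  refine ⟨fun s => α (a + s), ?_, by simp, by simp, ?_⟩
  · intro s hs t ht
    simp only [mem_Icc] at hs ht
    rw [hα _ ⟨by grind, by grind⟩ _ ⟨by grind, by grind⟩]
    congr 1
    abel
  · ext p
    constructor
    · rintro ⟨s, hs, rfl⟩
      simp only [mem_Icc] at hs
      exact ⟨a + s, ⟨by grind, by grind⟩, rfl⟩
    · rintro ⟨s, hs, rfl⟩
      simp only [mem_Icc] at hs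
      exact ⟨s - a, ⟨by grind, by grind⟩, by simp⟩

theorem IsSegment.symm {S : Set X} {x y : X} (h : IsSegment d S x y) : IsSegment d S y x := by
  obtain ⟨a, b, α, hab, hα, rfl, rfl, rfl⟩ := h
  refine ⟨-b, -a, fun s => α (-s), by grind, ?_, by simp, by simp, ?_⟩
  · intro s hs t ht
    simp only [mem_Icc] at hs ht
    rw [hα _ ⟨by grind, by grind⟩ _ ⟨by grind, by grind⟩]
    grind
  · ext p
    constructor
    · rintro ⟨s, hs, rfl⟩
      simp only [mem_Icc] at hs
      exact ⟨-s, ⟨by grind, by grind⟩, rfl⟩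
    · rintro ⟨s, hs, rfl⟩
      simp only [mem_Icc] at hs
      exact ⟨-s, ⟨by grind, by grind⟩, by simp⟩

variable [Module ℝ Λ]

/-- `0`-hyperbolicity with respect to one basepoint implies `0`-hyperbolicity. -/
theorem IsLambdaMetric.isLambdaHyperbolic_of_basepoint (hd : IsLambdaMetric d) (o : X)
    (h : ∀ x y z, min (gromovProduct d o x z) (gromovProduct d o y z) ≤ gromovProduct d o x y) :
    IsLambdaHyperbolic d 0 := by
  rw [isLambdaHyperbolic_zero_iff]
  intro v x y z
  have f1 := h x y z
  have f2 := h x y v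
  have g1 := h v z x
  have g2 := h v z y
  rw [gromovProduct_comm hd o x v] at f2
  rw [gromovProduct_comm hd o y v] at f2
  rw [gromovProduct_comm hd o z x] at g1
  rw [gromovProduct_comm hd o z y] at g2
  -- Since `(x·y)_v = d(o,v) + (x·y)_o - (x·v)_o - (y·v)_o`, the inequality at `v` becomes `min
  -- {(x·z)+(y·v), (y·z)+(x·v)} ≤ (x·y)+(z·v)` with all products at `o`.
  have key := min_add_le_add_of_min_le f1 f2 g1 g2
  have e1 := gromovProduct_add_self d o x y
  have e2 := gromovProduct_add_self d o x z
  have e3 := gromovProduct_add_self d o y z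
  have e4 := gromovProduct_add_self d o v z
  have e5 := gromovProduct_add_self d o v x
  have e6 := gromovProduct_add_self d o v y
  have h1 := gromovProduct_add_self d v x z
  have h2 := gromovProduct_add_self d v y z
  have h3 := gromovProduct_add_self d v x y
  clear h f1 f2 g1 g2
  grind

/-- In a `0`-hyperbolic space, points of two geodesics from `v` at the same distance from `v`
coincide up to the Gromov product of the endpoints. -/
theorem IsLambdaMetric.eq_of_le_gromovProduct (hd : IsLambdaMetric d)
    (h : IsLambdaHyperbolic d 0) {v x y p q : X} (hp : d v p + d p x = d v x)
    (hq : d v q + d q y = d v y) (hpq : d v p = d v q) (hle : d v p ≤ gromovProduct d v x y) :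
    p = q := by
  rw [isLambdaHyperbolic_zero_iff] at h
  -- Being on the geodesics means `(p·x)_v = d(v,p)` and `(q·y)_v = d(v,q)`. Hence `(q·x)_v ≥
  -- d(v,p)`, then `(p·q)_v ≥ d(v,p)`, which forces `d(p,q) ≤ 0`.
  have h1 := h v p q x
  have h2 := h v q x y
  have e1 := gromovProduct_add_self d v p x
  have e2 := gromovProduct_add_self d v q x
  have e3 := gromovProduct_add_self d v p q
  have e4 := gromovProduct_add_self d v q y
  have e5 := gromovProduct_add_self d v x y
  have n := hd.nonneg p q
  exact (hd.eq_zero_iff p q).1 (by grind)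

/-- Here `(x·p)_v = (y·p)_v = d(v,p)`, so hyperbolicity applies directly. Geodesics from `v`
therefore share no point beyond the Gromov product of their endpoints. -/
theorem IsLambdaMetric.le_gromovProduct (hd : IsLambdaMetric d)
    (h : IsLambdaHyperbolic d 0) {v x y p : X} (hp : d v p + d p x = d v x)
    (hq : d v p + d p y = d v y) : d v p ≤ gromovProduct d v x y := by
  rw [isLambdaHyperbolic_zero_iff] at h
  have h1 := h v x y p
  have e1 := gromovProduct_add_self d v x p
  have e2 := gromovProduct_add_self d v y p
  have s1 := hd.symm x p
  have s2 := hd.symm y p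
  grind

theorem IsLambdaMetric.gromovProduct_le_left (hd : IsLambdaMetric d) (v x y : X) :
    gromovProduct d v x y ≤ d v x := by
  have e1 := gromovProduct_add_self d v x y
  have := hd.triangle v y x
  grind

theorem IsLambdaMetric.gromovProduct_le_right (hd : IsLambdaMetric d) (v x y : X) :
    gromovProduct d v x y ≤ d v y := by
  have e1 := gromovProduct_add_self d v x y
  have := hd.triangle v x y
  have := hd.symm x y
  grind

theorem IsLambdaMetric.gromovProduct_nonneg (hd : IsLambdaMetric d) (v x y : X) :
    0 ≤ gromovProduct d v x y := by
  have e1 := gromovProduct_add_self d v x y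
  have := hd.triangle x y v
  have := hd.symm x v
  grind

/-- A geodesic `0`-hyperbolic space is a `Λ`-tree. -/
theorem IsLambdaMetric.isLambdaTree (hd : IsLambdaMetric d) (h : IsLambdaHyperbolic d 0)
    (hgeo : ∀ x y, ∃ S, IsSegment d S x y) : IsLambdaTree d := by
  refine ⟨hd, hgeo, ?_, ?_⟩
  · intro S T x y z hS hT hST
    obtain ⟨α, hα, α0, α1, rfl⟩ := hS.symm.exists_param
    obtain ⟨β, hβ, β0, β1, rfl⟩ := hT.exists_param
    have n1 := hd.nonneg y x
    have n2 := hd.nonneg y z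
    have dα : ∀ s ∈ Icc 0 (d y x), d y (α s) = s ∧ d (α s) x = d y x - s := by
      intro s hs
      have h1 := hα 0 ⟨le_rfl, n1⟩ s hs
      have h2 := hα s hs _ ⟨n1, le_rfl⟩
      rw [α0] at h1
      rw [α1] at h2
      simp only [mem_Icc] at hs
      grind
    have dβ : ∀ s ∈ Icc 0 (d y z), d y (β s) = s ∧ d (β s) z = d y z - s := by
      intro s hs
      have h1 := hβ 0 ⟨le_rfl, n2⟩ s hs
      have h2 := hβ s hs _ ⟨n2, le_rfl⟩
      rw [β0] at h1
      rw [β1] at h2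
      simp only [mem_Icc] at hs
      grind
    set m := gromovProduct d y x z with hm
    have m0 : 0 ≤ m := hd.gromovProduct_nonneg _ _ _
    have m1 : m ≤ d y x := hd.gromovProduct_le_left _ _ _
    have m2 : m ≤ d y z := hd.gromovProduct_le_right _ _ _
    have hαm := dα m ⟨m0, m1⟩
    have hβm := dβ m ⟨m0, m2⟩
    -- Both segments pass through the same point at distance `m = (x·z)_y` from `y`. As they meet
    -- only in `y`, this gives `m = 0`, that is, distances through `y` add.
    have hpq : α m = β m := by
      refine hd.eq_of_le_gromovProduct h (v := y) (x := x) (y := z) ?_ ?_ ?_ ?_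
      · rw [hαm.1, hαm.2]; abel
      · rw [hβm.1, hβm.2]; abel
      · rw [hαm.1, hβm.1]
      · rw [hαm.1]
    have hmem : α m ∈ ({y} : Set X) := by
      rw [← hST]
      exact ⟨⟨m, ⟨m0, m1⟩, rfl⟩, ⟨m, ⟨m0, m2⟩, hpq.symm⟩⟩
    have hm0 : m = 0 := by
      rw [← hαm.1, mem_singleton_iff.1 hmem, hd.dist_self]
    have hxz : d x z = d y x + d y z := by
      have e1 := gromovProduct_add_self d y x z
      grind
    -- The upper bound goes through `y`; the lower bound follows from `d(x,z) = d(y,x) + d(y,z)` by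
    -- going from `x` to `z` through the two points.
    have cross : ∀ s ∈ Icc 0 (d y x), ∀ t ∈ Icc 0 (d y z), d (α s) (β t) = s + t := by
      intro s hs t ht
      have h1 := dα s hs
      have h2 := dβ t ht
      have t1 := hd.triangle x z (α s)
      have t2 := hd.triangle (α s) z (β t)
      have t3 := hd.triangle (α s) (β t) y
      have s1 := hd.symm x (α s)
      have s2 := hd.symm (α s) y
      grind
    refine ⟨x, z, -d y x, d y z, fun s => if s ≤ 0 then α (-s) else β s, by grind, ?_, ?_, ?_, ?_⟩
    · intro s hs t ht
      simp only [mem_Icc] at hs ht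
      dsimp only
      split_ifs with c1 c2 c2
      · rw [hα _ ⟨by grind, by grind⟩ _ ⟨by grind, by grind⟩]
        grind
      · rw [cross _ ⟨by grind, by grind⟩ _ ⟨by grind, by grind⟩]
        grind
      · rw [hd.symm, cross _ ⟨by grind, by grind⟩ _ ⟨by grind, by grind⟩]
        grind
      · rw [hβ _ ⟨by grind, by grind⟩ _ ⟨by grind, by grind⟩]
    · simp [n1, α1]
    · dsimp only
      split_ifs with c1
      · have : d y z = 0 := le_antisymm c1 n2
        rw [this] at β1 ⊢
        rw [neg_zero, α0, ← β0, β1]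
      · exact β1
    · ext p
      constructor
      · rintro ⟨s, hs, rfl⟩
        simp only [mem_Icc] at hs
        dsimp only
        split_ifs with c1
        · exact Or.inl ⟨-s, ⟨by grind, by grind⟩, rfl⟩
        · exact Or.inr ⟨s, ⟨by grind, by grind⟩, rfl⟩
      · rintro (⟨s, hs, rfl⟩ | ⟨s, hs, rfl⟩)
        · simp only [mem_Icc] at hs
          exact ⟨-s, ⟨by grind, by grind⟩, by simp [hs.1]⟩
        · simp only [mem_Icc] at hs
          refine ⟨s, ⟨by grind, by grind⟩, ?_⟩
          dsimp only
          split_ifs with c1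
          · have : s = 0 := le_antisymm c1 hs.1
            rw [this, neg_zero, α0, β0]
          · rfl
  · intro S T x y z hS hT
    obtain ⟨α, hα, α0, α1, rfl⟩ := hS.exists_param
    obtain ⟨β, hβ, β0, β1, rfl⟩ := hT.exists_param
    have n1 := hd.nonneg x y
    have n2 := hd.nonneg x z
    have dα : ∀ s ∈ Icc 0 (d x y), d x (α s) = s ∧ d (α s) y = d x y - s := by
      intro s hs
      have h1 := hα 0 ⟨le_rfl, n1⟩ s hs
      have h2 := hα s hs _ ⟨n1, le_rfl⟩
      rw [α0] at h1
      rw [α1] at h2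
      simp only [mem_Icc] at hs
      grind
    have dβ : ∀ s ∈ Icc 0 (d x z), d x (β s) = s ∧ d (β s) z = d x z - s := by
      intro s hs
      have h1 := hβ 0 ⟨le_rfl, n2⟩ s hs
      have h2 := hβ s hs _ ⟨n2, le_rfl⟩
      rw [β0] at h1
      rw [β1] at h2
      simp only [mem_Icc] at hs
      grind
    set m := gromovProduct d x y z with hm
    have m0 : 0 ≤ m := hd.gromovProduct_nonneg _ _ _
    have m1 : m ≤ d x y := hd.gromovProduct_le_left _ _ _
    have m2 : m ≤ d x z := hd.gromovProduct_le_right _ _ _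
    -- Two geodesics from `x` agree exactly up to the Gromov product of their other endpoints.
    refine ⟨α 0, α m, 0, m, α, m0, ?_, rfl, rfl, ?_⟩
    · intro s hs t ht
      exact hα s ⟨hs.1, hs.2.trans m1⟩ t ⟨ht.1, ht.2.trans m1⟩
    · ext p
      constructor
      · rintro ⟨s, hs, rfl⟩
        refine ⟨⟨s, ⟨hs.1, hs.2.trans m1⟩, rfl⟩, s, ⟨hs.1, hs.2.trans m2⟩, ?_⟩
        have h1 := dα s ⟨hs.1, hs.2.trans m1⟩
        have h2 := dβ s ⟨hs.1, hs.2.trans m2⟩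
        refine (hd.eq_of_le_gromovProduct h (v := x) (x := y) (y := z) ?_ ?_ ?_ ?_).symm
        · rw [h1.1, h1.2]; abel
        · rw [h2.1, h2.2]; abel
        · rw [h1.1, h2.1]
        · rw [h1.1]; exact hs.2
      · rintro ⟨⟨s, hs, rfl⟩, t, ht, hst⟩
        have h1 := dα s hs
        have h2 := dβ t ht
        rw [hst] at h2
        have := hd.le_gromovProduct h (v := x) (x := y) (y := z) (p := α s)
          (by rw [h1.1, h1.2]; abel) (by rw [h2.1, h2.2]; abel)
        rw [h1.1] at this
        exact ⟨s, ⟨hs.1, this⟩, rfl⟩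

end LambdaTree

/-! ### The `Λ`-tree spanned by a `0`-hyperbolic space -/

section SpanTree

variable {Λ : Type*} [AddCommGroup Λ] [LinearOrder Λ] [Module ℝ Λ] {X : Type*}

/-- The distances from the points of a `0`-hyperbolic space `X` to the point at distance `r` from
`a` on the segment joining `a` to `b` in the tree spanned by `X`. -/
noncomputable def segmentDist (d : X → X → Λ) (a b : X) (r : Λ) : X → Λ :=
  fun k => d a k + r - 2 • min r (gromovProduct d a k b)

/-- The `Λ`-tree spanned by a `0`-hyperbolic space `X`: the points of the segments between points
of `X`, each given by its distances from the points of `X`. -/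
def SpanTree (d : X → X → Λ) : Type _ :=
  {f : X → Λ // ∃ a b r, r ∈ Icc 0 (d a b) ∧ f = segmentDist d a b r}

/-- The point at distance `r` from `a` on the segment from `a` to `b`. -/
noncomputable def SpanTree.point (d : X → X → Λ) (a b : X) (r : Λ) (hr : r ∈ Icc 0 (d a b)) :
    SpanTree d :=
  ⟨segmentDist d a b r, a, b, r, hr, rfl⟩

open scoped Classical in
/-- The distance of the tree: the largest difference of the distances from a point of `X`. -/
noncomputable def SpanTree.dist (d : X → X → Λ) (f g : SpanTree d) : Λ :=
  if h : ∃ m, IsGreatest (range fun k => |f.1 k - g.1 k|) m then h.choose else 0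

/-- Suprema need not exist in `Λ`, so distances are computed by exhibiting a maximum. For a
`0`-hyperbolic metric one always exists, and the default value `0` never intervenes. -/
theorem SpanTree.dist_eq_of_isGreatest {d : X → X → Λ} {f g : SpanTree d} {m : Λ}
    (h : IsGreatest (range fun k => |f.1 k - g.1 k|) m) : SpanTree.dist d f g = m := by
  have h' : ∃ m, IsGreatest (range fun k => |f.1 k - g.1 k|) m := ⟨m, h⟩
  rw [SpanTree.dist, dif_pos h']
  exact h'.choose_spec.unique h

variable {d : X → X → Λ}

/-- The segments from `a` to `b` and to `c` coincide up to `(b·c)_a`: by hyperbolicity `(k·b)_a` and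
`(k·c)_a` agree once truncated at such an `r`. -/
theorem segmentDist_eq_of_le (hd : IsLambdaMetric d) (h : IsLambdaHyperbolic d 0) {a b c : X}
    {r : Λ} (hr : r ≤ gromovProduct d a b c) : segmentDist d a b r = segmentDist d a c r := by
  rw [isLambdaHyperbolic_zero_iff] at h
  funext k
  simp only [segmentDist]
  have h1 := h a k b c
  have h2 := h a k c b
  have s := gromovProduct_comm hd a b c
  have : min r (gromovProduct d a k b) = min r (gromovProduct d a k c) := by grind
  rw [this]

variable [IsOrderedAddMonoid Λ]

/-- The identity `(k·b)_a + (k·a)_b = d(a,b)` turns one expression into the other; hyperbolicity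
plays no part. -/
theorem segmentDist_reverse (hd : IsLambdaMetric d) (a b : X) (r : Λ) :
    segmentDist d a b r = segmentDist d b a (d a b - r) := by
  funext k
  simp only [segmentDist]
  have e1 := gromovProduct_add_self d a k b
  have e2 := gromovProduct_add_self d b k a
  have s1 := hd.symm a b
  have s2 := hd.symm k a
  have s3 := hd.symm k b
  grind

/-- Every point of the tree lies on a segment starting at a given point of `X`. -/
theorem SpanTree.exists_eq_point (hd : IsLambdaMetric d) (h : IsLambdaHyperbolic d 0)
    (f : SpanTree d) (o : X) :
    ∃ (b : X) (r : Λ) (hr : r ∈ Icc 0 (d o b)), f = SpanTree.point d o b r hr := by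
  obtain ⟨_, a, b, r, hr, rfl⟩ := f
  simp only [mem_Icc] at hr
  have key : ∀ a b r, 0 ≤ r → r ≤ d a b → r ≤ gromovProduct d a b o →
      ∃ (c : X) (s : Λ) (_ : s ∈ Icc 0 (d o c)),
        segmentDist d a b r = segmentDist d o c s := by
    intro a b r h0 h1 h2
    have h3 := hd.gromovProduct_le_right a b o
    have h4 := hd.symm a o
    refine ⟨a, d a o - r, ⟨by grind, by grind⟩, ?_⟩
    rw [segmentDist_eq_of_le hd h h2, segmentDist_reverse hd]
  have : ∃ (c : X) (s : Λ) (_ : s ∈ Icc 0 (d o c)),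
        segmentDist d a b r = segmentDist d o c s := by
    -- Because `(b·o)_a + (a·o)_b = d(a,b)`, the point is within the Gromov product of one end of
    -- the segment; from that end it also lies on the segment to `o`.
    rcases le_total r (gromovProduct d a b o) with hle | hle
    · exact key a b r hr.1 hr.2 hle
    · rw [segmentDist_reverse hd]
      have e1 := gromovProduct_add_self d a b o
      have e2 := gromovProduct_add_self d b a o
      have s1 := hd.symm a b
      exact key b a _ (by grind) (by grind) (by grind)
  obtain ⟨c, s, hs, e⟩ := this
  exact ⟨c, s, hs, Subtype.ext e⟩

/-- The value is attained at `k = o` if the first point lies on the segment to the second, and at `k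
= a` otherwise. The bound for the other `k` is hyperbolicity for `k`, `a`, `b`. -/
theorem SpanTree.isGreatest_point (hd : IsLambdaMetric d) (h : IsLambdaHyperbolic d 0)
    {o a b : X} {r s : Λ} (hr : r ∈ Icc 0 (d o a)) (hs : s ∈ Icc 0 (d o b)) :
    IsGreatest (range fun k =>
      |(SpanTree.point d o a r hr).1 k - (SpanTree.point d o b s hs).1 k|)
      (r + s - 2 • min r (min s (gromovProduct d o a b))) := by
  rw [isLambdaHyperbolic_zero_iff] at h
  simp only [mem_Icc] at hr hs
  constructor
  · rcases le_total r (min s (gromovProduct d o a b)) with hle | hle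
    · refine ⟨o, ?_⟩
      simp only [SpanTree.point, segmentDist]
      have e1 := gromovProduct_add_self d o o a
      have e2 := gromovProduct_add_self d o o b
      have e3 := hd.dist_self o
      have n1 : gromovProduct d o o a = 0 := by grind
      have n2 : gromovProduct d o o b = 0 := by grind
      rw [n1, n2]
      grind
    · refine ⟨a, ?_⟩
      simp only [SpanTree.point, segmentDist]
      have e1 := gromovProduct_add_self d o a a
      have e3 := hd.dist_self a
      have n1 : gromovProduct d o a a = d o a := by grind
      rw [n1]
      grind
  · rintro _ ⟨k, rfl⟩
    simp only [SpanTree.point, segmentDist]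
    have h1 := h o k a b
    have h2 := h o k b a
    have s := gromovProduct_comm hd o b a
    rw [s] at h2
    have n1 := hd.gromovProduct_nonneg o k a
    have n2 := hd.gromovProduct_nonneg o k b
    have n3 := hd.gromovProduct_nonneg o a b
    rw [abs_le]
    constructor <;> grind

theorem SpanTree.dist_point (hd : IsLambdaMetric d) (h : IsLambdaHyperbolic d 0)
    {o a b : X} {r s : Λ} (hr : r ∈ Icc 0 (d o a)) (hs : s ∈ Icc 0 (d o b)) :
    SpanTree.dist d (SpanTree.point d o a r hr) (SpanTree.point d o b s hs) =
      r + s - 2 • min r (min s (gromovProduct d o a b)) :=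
  SpanTree.dist_eq_of_isGreatest (SpanTree.isGreatest_point hd h hr hs)

theorem SpanTree.dist_point_self (hd : IsLambdaMetric d) (h : IsLambdaHyperbolic d 0)
    {o a : X} {r s : Λ} (hr : r ∈ Icc 0 (d o a)) (hs : s ∈ Icc 0 (d o a)) :
    SpanTree.dist d (SpanTree.point d o a r hr) (SpanTree.point d o a s hs) = |r - s| := by
  rw [SpanTree.dist_point hd h]
  have e1 := gromovProduct_add_self d o a a
  have e3 := hd.dist_self a
  simp only [mem_Icc] at hr hs
  grind

theorem SpanTree.isGreatest_dist (hd : IsLambdaMetric d) (h : IsLambdaHyperbolic d 0)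
    (f g : SpanTree d) :
    IsGreatest (range fun k => |f.1 k - g.1 k|) (SpanTree.dist d f g) := by
  obtain ⟨_, o, a, r, hr, rfl⟩ := f
  obtain ⟨b, s, hs, rfl⟩ := g.exists_eq_point hd h o
  have := SpanTree.isGreatest_point hd h hr hs
  rwa [← SpanTree.dist_eq_of_isGreatest this] at this

theorem SpanTree.isLambdaMetric (hd : IsLambdaMetric d) (h : IsLambdaHyperbolic d 0) :
    IsLambdaMetric (SpanTree.dist d) := by
  refine ⟨?_, ?_, ?_, ?_⟩
  · intro f g
    obtain ⟨k, hk⟩ := (SpanTree.isGreatest_dist hd h f g).1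
    rw [← hk]
    exact abs_nonneg _
  · intro f g
    constructor
    · intro e
      refine Subtype.ext (funext fun k => ?_)
      have := (SpanTree.isGreatest_dist hd h f g).2 ⟨k, rfl⟩
      rw [e] at this
      exact sub_eq_zero.1 (abs_nonpos_iff.1 this)
    · rintro rfl
      obtain ⟨k, hk⟩ := (SpanTree.isGreatest_dist hd h f f).1
      rw [← hk]
      simp
  · intro f g
    refine SpanTree.dist_eq_of_isGreatest ?_
    have := SpanTree.isGreatest_dist hd h g f
    simpa only [abs_sub_comm] using this
  · intro f g e
    obtain ⟨k, hk⟩ := (SpanTree.isGreatest_dist hd h f g).1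
    rw [← hk]
    refine (abs_sub_le _ (e.1 k) _).trans (add_le_add ?_ ?_)
    · exact (SpanTree.isGreatest_dist hd h f e).2 ⟨k, rfl⟩
    · exact (SpanTree.isGreatest_dist hd h e g).2 ⟨k, rfl⟩

/-- Based at a point of `X`, the product on the tree is that of `X` truncated by the two heights.
Truncation by minima preserves the ultrametric inequality, so hyperbolicity is inherited. -/
theorem SpanTree.gromovProduct_basepoint (hd : IsLambdaMetric d) (h : IsLambdaHyperbolic d 0)
    {o a b : X} {r s : Λ} (h0 : (0 : Λ) ∈ Icc 0 (d o o)) (hr : r ∈ Icc 0 (d o a))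
    (hs : s ∈ Icc 0 (d o b)) :
    gromovProduct (SpanTree.dist d) (SpanTree.point d o o 0 h0) (SpanTree.point d o a r hr)
      (SpanTree.point d o b s hs) = min r (min s (gromovProduct d o a b)) := by
  have e := gromovProduct_add_self (SpanTree.dist d) (SpanTree.point d o o 0 h0)
    (SpanTree.point d o a r hr) (SpanTree.point d o b s hs)
  rw [SpanTree.dist_point hd h, SpanTree.dist_point hd h, SpanTree.dist_point hd h] at e
  simp only [mem_Icc] at hr hs
  have n1 := hd.gromovProduct_nonneg o o a
  have n2 := hd.gromovProduct_nonneg o o b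
  grind

theorem SpanTree.isLambdaHyperbolic (hd : IsLambdaMetric d) (h : IsLambdaHyperbolic d 0) :
    IsLambdaHyperbolic (SpanTree.dist d) 0 := by
  have hm := SpanTree.isLambdaMetric hd h
  intro v
  -- `X` is not assumed nonempty; a point of the tree supplies a basepoint.
  obtain ⟨_, o, -⟩ := v.2
  have h0 : (0 : Λ) ∈ Icc 0 (d o o) := ⟨le_rfl, hd.nonneg o o⟩
  refine hm.isLambdaHyperbolic_of_basepoint (SpanTree.point d o o 0 h0) ?_ v
  intro x y z
  obtain ⟨a, r, hr, rfl⟩ := x.exists_eq_point hd h o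
  obtain ⟨b, s, hs, rfl⟩ := y.exists_eq_point hd h o
  obtain ⟨c, t, ht, rfl⟩ := z.exists_eq_point hd h o
  rw [SpanTree.gromovProduct_basepoint hd h, SpanTree.gromovProduct_basepoint hd h,
    SpanTree.gromovProduct_basepoint hd h]
  rw [isLambdaHyperbolic_zero_iff] at h
  have := h o a b c
  grind

/-- The path descends from `f` to the branch point at height `m` and climbs to `g`, with the
parameter `0` at the branch point. -/
theorem SpanTree.exists_isSegment (hd : IsLambdaMetric d) (h : IsLambdaHyperbolic d 0)
    (f g : SpanTree d) : ∃ S, IsSegment (SpanTree.dist d) S f g := by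
  classical
  obtain ⟨_, o, a, r, hr, rfl⟩ := f
  obtain ⟨b, s, hs, rfl⟩ := g.exists_eq_point hd h o
  have n := hd.gromovProduct_nonneg o a b
  have hsm := (SpanTree.isLambdaMetric hd h).symm
  set c := gromovProduct d o a b with hc
  set m := min r (min s c) with hm
  have hr' := hr
  have hs' := hs
  simp only [mem_Icc] at hr' hs'
  have m0 : 0 ≤ m := by grind
  have m1 : m ≤ r := by grind
  have m2 : m ≤ s := by grind
  have m3 : m ≤ c := by grind
  have ha : ∀ u, m - r ≤ u → u ≤ 0 → m - u ∈ Icc 0 (d o a) := fun u h1 h2 => ⟨by grind, by grind⟩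
  have hb : ∀ u, 0 ≤ u → u ≤ s - m → m + u ∈ Icc 0 (d o b) := fun u h1 h2 => ⟨by grind, by grind⟩
  have cross : ∀ u v (hu : u ∈ Icc 0 (d o a)) (hv : v ∈ Icc 0 (d o b)), m ≤ u → u ≤ r → m ≤ v →
      v ≤ s → SpanTree.dist d (SpanTree.point d o a u hu) (SpanTree.point d o b v hv) =
        u + v - 2 • m := by
    intro u v hu hv h1 h2 h3 h4
    rw [SpanTree.dist_point hd h, ← hc]
    grind
  -- The two legs fit together because `m` does not exceed the Gromov product `c`.
  have ends : SpanTree.point d o a m ⟨m0, m1.trans hr.2⟩ =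
      SpanTree.point d o b m ⟨m0, m2.trans hs.2⟩ :=
    Subtype.ext (segmentDist_eq_of_le hd h m3)
  clear hm
  clear_value m
  let α : Λ → SpanTree d := fun u =>
    if h1 : m - u ∈ Icc 0 (d o a) ∧ u ≤ 0 then SpanTree.point d o a (m - u) h1.1 else
    if h2 : m + u ∈ Icc 0 (d o b) then SpanTree.point d o b (m + u) h2 else
    SpanTree.point d o a r hr
  have α1 : ∀ u (h1 : m - r ≤ u) (h2 : u ≤ 0),
      α u = SpanTree.point d o a (m - u) (ha u h1 h2) := by
    intro u h1 h2
    exact dif_pos ⟨ha u h1 h2, h2⟩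
  have α2 : ∀ u (h1 : 0 ≤ u) (h2 : u ≤ s - m),
      α u = SpanTree.point d o b (m + u) (hb u h1 h2) := by
    intro u h1 h2
    rcases h1.eq_or_lt with rfl | h1
    · rw [α1 0 (sub_nonpos.2 m1) le_rfl]
      simpa using ends
    · have : ¬ (m - u ∈ Icc 0 (d o a) ∧ u ≤ 0) := fun h => absurd h.2 (not_le.2 h1)
      simp only [α]
      rw [dif_neg this, dif_pos (hb u h1.le h2)]
  clear_value α
  have hmr : m - r ≤ 0 := sub_nonpos.2 m1
  have hms : 0 ≤ s - m := sub_nonneg.2 m2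
  refine ⟨_, m - r, s - m, α, hmr.trans hms, ?_, ?_, ?_, rfl⟩
  · intro u hu v hv
    simp only [mem_Icc] at hu hv
    have c1 : ∀ {u}, u ≤ 0 → m ≤ m - u := fun h => (le_sub_self_iff _).2 h
    have c2 : ∀ {u}, 0 ≤ u → m ≤ m + u := fun h => le_add_of_nonneg_right h
    have c3 : ∀ {u}, m - r ≤ u → m - u ≤ r := fun h => sub_le_comm.1 h
    have c4 : ∀ {u}, u ≤ s - m → m + u ≤ s := fun h => le_sub_iff_add_le'.1 h
    rcases le_total u 0 with cu | cu <;> rcases le_total v 0 with cv | cv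
    · rw [α1 u hu.1 cu, α1 v hv.1 cv, SpanTree.dist_point_self hd h, abs_sub_comm u v]
      congr 1
      abel
    · rw [α1 u hu.1 cu, α2 v cv hv.2, cross _ _ _ _ (c1 cu) (c3 hu.1) (c2 cv) (c4 hv.2),
        abs_of_nonpos (sub_nonpos.2 (cu.trans cv))]
      abel
    · rw [hsm, α2 u cu hu.2, α1 v hv.1 cv, cross _ _ _ _ (c1 cv) (c3 hv.1) (c2 cu) (c4 hu.2),
        abs_of_nonneg (sub_nonneg.2 (cv.trans cu))]
      abel
    · rw [α2 u cu hu.2, α2 v cv hv.2, SpanTree.dist_point_self hd h]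
      congr 1
      abel
  · rw [α1 _ le_rfl hmr]
    simp only [sub_sub_cancel]
    rfl
  · rw [α2 _ hms le_rfl]
    simp

theorem SpanTree.isLambdaTree (hd : IsLambdaMetric d) (h : IsLambdaHyperbolic d 0) :
    IsLambdaTree (SpanTree.dist d) :=
  (SpanTree.isLambdaMetric hd h).isLambdaTree (SpanTree.isLambdaHyperbolic hd h)
    (SpanTree.exists_isSegment hd h)

end SpanTree

/-! ### Left translation on the spanned tree -/

section SpanTreeAction

variable {Λ : Type*} [AddCommGroup Λ] [LinearOrder Λ] [Module ℝ Λ] {G : Type*} [Group G]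
  {d : G → G → Λ}

theorem segmentDist_smul (hinv : ∀ g a b, d (g * a) (g * b) = d a b) (g a b : G) (r : Λ) (k : G) :
    segmentDist d (g * a) (g * b) r k = segmentDist d a b r (g⁻¹ * k) := by
  have e : ∀ x, d (g * x) k = d x (g⁻¹ * k) := fun x => by
    rw [← hinv g x, mul_inv_cancel_left]
  have e' : ∀ x, d k (g * x) = d (g⁻¹ * k) x := fun x => by
    rw [← hinv g _ x, mul_inv_cancel_left]
  simp only [segmentDist, gromovProduct, e, e', hinv]

/-- Left translation of the tree spanned by a group with a left invariant metric. -/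
noncomputable abbrev SpanTree.mulAction (hinv : ∀ g a b, d (g * a) (g * b) = d a b) :
    MulAction G (SpanTree d) where
  smul g f := ⟨fun k => f.1 (g⁻¹ * k), by
    obtain ⟨_, a, b, r, hr, rfl⟩ := f
    exact ⟨g * a, g * b, r, by rwa [hinv], funext fun k => (segmentDist_smul hinv g a b r k).symm⟩⟩
  one_smul f := Subtype.ext (funext fun k => congrArg f.1 (by simp))
  mul_smul g h f := Subtype.ext (funext fun k => congrArg f.1 (by simp [mul_assoc]))

theorem SpanTree.dist_smul [IsOrderedAddMonoid Λ] (hd : IsLambdaMetric d)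
    (h : IsLambdaHyperbolic d 0)
    (hinv : ∀ g a b, d (g * a) (g * b) = d a b) (g : G) (x y : SpanTree d) :
    letI := SpanTree.mulAction hinv
    SpanTree.dist d (g • x) (g • y) = SpanTree.dist d x y := by
  refine SpanTree.dist_eq_of_isGreatest ?_
  have := SpanTree.isGreatest_dist hd h x y
  convert this using 1
  -- Translation only permutes the points `k` over which the maximum is taken.
  exact (Group.mulLeft_bijective g⁻¹).surjective.range_comp (fun k => |x.1 k - y.1 k|)

end SpanTreeAction

/-! ### Noncrossing pairings of subsets of a word -/

theorem Letter.inv_ne {A : Type u} (x : Letter A) : x.inv ≠ x := by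
  intro h
  have := congrArg Prod.snd h
  simp [Letter.inv] at this

namespace TransfiniteWord

variable {A : Type u}

/-- `star` is a noncrossing pairing of the subset `V` of the index set of `w`, matching inverse
letters. -/
structure PairsOn (w : TransfiniteWord A) (V : Set w.carrier) (star : w.carrier → w.carrier) :
    Prop where
  map : ∀ t ∈ V, star t ∈ V
  inv : ∀ t ∈ V, star (star t) = t
  noncrossing : ∀ t ∈ V, ∀ r ∈ V, t ≤ r → r ≤ star t → t ≤ star r ∧ star r ≤ star t
  letter : ∀ t ∈ V, w.letter (star t) = (w.letter t).inv

/-- The restriction of `w` to `V` has a complete cancellation. -/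
def Pairable (w : TransfiniteWord A) (V : Set w.carrier) : Prop := ∃ star, w.PairsOn V star

variable {w v : TransfiniteWord A}

theorem PairsOn.ne {V : Set w.carrier} {star : w.carrier → w.carrier} (h : w.PairsOn V star)
    {t : w.carrier} (ht : t ∈ V) : star t ≠ t := by
  intro e
  have := h.letter t ht
  rw [e] at this
  exact Letter.inv_ne _ this.symm

/-- A pairing, unlike a cancellation, need not contain the intervals between paired indices. It
therefore restricts to any stable subset, such as the indices with letters from finitely many
generators. -/
theorem PairsOn.mono {V C : Set w.carrier} {star : w.carrier → w.carrier} (h : w.PairsOn V star)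
    (hC : C ⊆ V) (hmap : ∀ t ∈ C, star t ∈ C) : w.PairsOn C star :=
  ⟨hmap, fun t ht => h.inv t (hC ht),
    fun t ht r hr => h.noncrossing t (hC ht) r (hC hr), fun t ht => h.letter t (hC ht)⟩

/-- The noncrossing pairing of the support of a cancellation. -/
theorem Cancellation.pairsOn (c : w.Cancellation) : w.PairsOn c.support c.star :=
  ⟨c.star_mem, c.star_star, fun _ ht _ _ h1 h2 => c.star_mem_Icc ht ⟨h1, h2⟩, c.letter_star⟩

/-- A noncrossing pairing of a union of intervals between paired indices is a cancellation. -/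
def PairsOn.cancellation {V : Set w.carrier} {star : w.carrier → w.carrier}
    (h : w.PairsOn V star) (hV : ∀ t ∈ V, Icc t (star t) ⊆ V) : w.Cancellation where
  support := V
  star := star
  star_mem := h.map
  star_star := h.inv
  complete := hV
  noncrossing t ht := image_star_eq (hV t ht) h.inv
    (fun r hr => h.noncrossing t ht r (hV t ht hr) hr.1 hr.2)
  letter_star := h.letter

/-- Any nonempty cancellation restricts to the interval between an index and its partner, so
intervals suffice as supports. -/
theorem isReduced_iff : w.IsReduced ↔ ∀ a b, a ≤ b → ¬ w.Pairable (Icc a b) := by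
  constructor
  · rintro h a b hab ⟨star, hs⟩
    have := h (hs.cancellation fun t ht => Icc_subset_Icc ht.1 (hs.map t ht).2)
    exact (this ▸ (⟨le_rfl, hab⟩ : a ∈ Icc a b) : a ∈ (∅ : Set w.carrier))
  · intro h c
    have key : ∀ t ∈ c.support, ¬ t ≤ c.star t := fun t ht hle =>
      h t _ hle ⟨c.star, c.pairsOn.mono (c.complete t ht) fun r hr => c.star_mem_Icc ht hr⟩
    rw [eq_empty_iff_forall_notMem]
    intro t ht
    have h1 := key t ht
    have h2 := key _ (c.star_mem t ht)
    rw [c.star_star t ht] at h2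
    exact h2 (le_of_not_ge h1)

theorem pairable_image_iff (f : v.carrier ↪o w.carrier) (hl : ∀ s, w.letter (f s) = v.letter s)
    (V : Set v.carrier) : w.Pairable (f '' V) ↔ v.Pairable V := by
  classical
  constructor
  · rintro ⟨star, h⟩
    have h1 : ∀ t : v.carrier, ∃ r, t ∈ V → r ∈ V ∧ f r = star (f t) := by
      intro t
      by_cases ht : t ∈ V
      · obtain ⟨r, hr, e⟩ := h.map (f t) ⟨t, ht, rfl⟩
        exact ⟨r, fun _ => ⟨hr, e⟩⟩
      · exact ⟨t, fun h => absurd h ht⟩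
    choose g hg using h1
    refine ⟨g, fun t ht => (hg t ht).1, ?_, ?_, ?_⟩
    · intro t ht
      apply f.injective
      rw [(hg _ (hg t ht).1).2, (hg t ht).2, h.inv _ ⟨t, ht, rfl⟩]
    · intro t ht r hr h1 h2
      have := h.noncrossing (f t) ⟨t, ht, rfl⟩ (f r) ⟨r, hr, rfl⟩ (f.le_iff_le.2 h1)
        (by rw [← (hg t ht).2]; exact f.le_iff_le.2 h2)
      rwa [← (hg t ht).2, ← (hg r hr).2, f.le_iff_le, f.le_iff_le] at this
    · intro t ht
      rw [← hl, (hg t ht).2, h.letter _ ⟨t, ht, rfl⟩, hl]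
  · rintro ⟨star, h⟩
    have h1 : ∀ t : w.carrier, ∃ r, ∀ s ∈ V, f s = t → r = f (star s) := by
      intro t
      by_cases ht : ∃ s ∈ V, f s = t
      · obtain ⟨s, hs, rfl⟩ := ht
        exact ⟨f (star s), fun s' _ e => by rw [f.injective e]⟩
      · exact ⟨t, fun s hs e => absurd ⟨s, hs, e⟩ ht⟩
    choose g hg using h1
    have hg' : ∀ s ∈ V, g (f s) = f (star s) := fun s hs => hg _ s hs rfl
    refine ⟨g, ?_, ?_, ?_, ?_⟩
    · rintro _ ⟨s, hs, rfl⟩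
      rw [hg' s hs]
      exact ⟨_, h.map s hs, rfl⟩
    · rintro _ ⟨s, hs, rfl⟩
      rw [hg' s hs, hg' _ (h.map s hs), h.inv s hs]
    · rintro _ ⟨s, hs, rfl⟩ _ ⟨r, hr, rfl⟩ h1 h2
      rw [hg' s hs, f.le_iff_le] at h2
      rw [f.le_iff_le] at h1
      rw [hg' s hs, hg' r hr, f.le_iff_le, f.le_iff_le]
      exact h.noncrossing s hs r hr h1 h2
    · rintro _ ⟨s, hs, rfl⟩
      rw [hg' s hs, hl, hl, h.letter s hs]

theorem pairable_inverse_iff (V : Set w.carrier) :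
    w.inverse.Pairable (OrderDual.ofDual ⁻¹' V) ↔ w.Pairable V := by
  -- `noncrossing` speaks of indices with `t ≤ r ≤ t*`; its mirror image is the same condition
  -- applied to the partner of `t`.
  have hnc : ∀ {u : TransfiniteWord A} {V : Set u.carrier} {star : u.carrier → u.carrier},
      u.PairsOn V star → ∀ t ∈ V, ∀ r ∈ V, r ≤ t → star t ≤ r → star r ≤ t ∧ star t ≤ star r := by
    intro u V star h t ht r hr h1 h2
    have := h.noncrossing _ (h.map t ht) r hr h2 (by rwa [h.inv t ht])
    rw [h.inv t ht] at this
    exact this.symm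
  constructor
  · rintro ⟨star, h⟩
    refine ⟨fun t => OrderDual.ofDual (star (OrderDual.toDual t)), h.map, h.inv, hnc h, ?_⟩
    intro t ht
    have := congrArg Letter.inv (h.letter t ht)
    simp only [inverse, Letter.inv_inv] at this
    exact this
  · rintro ⟨star, h⟩
    exact ⟨fun t => OrderDual.toDual (star (OrderDual.ofDual t)), h.map, h.inv, hnc h,
      fun t ht => congrArg Letter.inv (h.letter _ ht)⟩

theorem IsReduced.inverse (h : w.IsReduced) : w.inverse.IsReduced := by
  rw [isReduced_iff] at h ⊢
  intro a b hab hp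
  refine h (OrderDual.ofDual b) (OrderDual.ofDual a) hab ?_
  rw [← pairable_inverse_iff]
  convert hp using 1
  ext s
  exact and_comm

theorem image_Icc_of_ordConnected (f : v.carrier ↪o w.carrier) (hf : (range f).OrdConnected)
    (a b : v.carrier) : f '' Icc a b = Icc (f a) (f b) := by
  ext s
  constructor
  · rintro ⟨r, hr, rfl⟩
    exact ⟨f.le_iff_le.2 hr.1, f.le_iff_le.2 hr.2⟩
  · intro hs
    obtain ⟨r, rfl⟩ := hf.out (mem_range_self a) (mem_range_self b) hs
    exact ⟨r, ⟨f.le_iff_le.1 hs.1, f.le_iff_le.1 hs.2⟩, rfl⟩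

/-- Convexity makes intervals of the subword intervals of `w`, so a pairing of one is a pairing of
the other. -/
theorem IsReduced.of_ordConnected (h : w.IsReduced) (f : v.carrier ↪o w.carrier)
    (hl : ∀ s, w.letter (f s) = v.letter s) (hf : (range f).OrdConnected) : v.IsReduced := by
  rw [isReduced_iff] at h ⊢
  intro a b hab hp
  refine h (f a) (f b) (f.le_iff_le.2 hab) ?_
  rw [← image_Icc_of_ordConnected f hf]
  exact (pairable_image_iff f hl _).2 hp

/-- A pairing of an interval does not match two indices of a reduced convex subword. -/
theorem PairsOn.not_mem_range (hv : v.IsReduced) (f : v.carrier ↪o w.carrier)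
    (hl : ∀ s, w.letter (f s) = v.letter s) (hf : (range f).OrdConnected) {V : Set w.carrier}
    (hV : V.OrdConnected) {star : w.carrier → w.carrier} (h : w.PairsOn V star) {s r : v.carrier}
    (hs : f s ∈ V) : star (f s) ≠ f r := by
  rw [isReduced_iff] at hv
  have key : ∀ {s r : v.carrier}, f s ∈ V → star (f s) = f r → ¬ s ≤ r := by
    intro s r hs e hle
    refine hv s r hle ((pairable_image_iff f hl _).1 ?_)
    rw [image_Icc_of_ordConnected f hf]
    have hsub : Icc (f s) (f r) ⊆ V := hV.out hs (e ▸ h.map _ hs)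
    refine ⟨star, h.mono hsub fun t ht => ?_⟩
    have := h.noncrossing _ hs t (hsub ht) ht.1 (by rw [e]; exact ht.2)
    rwa [e] at this
  intro e
  rcases le_total s r with hle | hle
  · exact key hs e hle
  · refine key (s := r) (r := s) (e ▸ h.map _ hs) ?_ hle
    rw [← e, h.inv _ hs]

/-! ### Confluence -/

/-- Removing an adjacent pair of inverse letters from a word with a complete cancellation leaves a
word with a complete cancellation. -/
theorem Pairable.diff_adjacent {V : Set w.carrier} (h : w.Pairable V) {t t' : w.carrier}
    (ht : t ∈ V) (ht' : t' ∈ V) (hlt : t < t') (hadj : ∀ r ∈ V, t ≤ r → r ≤ t' → r = t ∨ r = t')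
    (hl : w.letter t' = (w.letter t).inv) : w.Pairable (V \ {t, t'}) := by
  classical
  obtain ⟨d, hd⟩ := h
  by_cases hdt : d t = t'
  · refine ⟨d, hd.mono sdiff_subset ?_⟩
    rintro r ⟨hr, hne⟩
    refine ⟨hd.map r hr, ?_⟩
    have := hd.inv r hr
    have := hd.inv t ht
    simp only [mem_insert_iff, mem_singleton_iff] at hne ⊢
    grind
  have hdt' : d t' ≠ t := fun e => hdt (by rw [← e, hd.inv t' ht'])
  have i1 := hd.inv t ht
  have i2 := hd.inv t' ht'
  have m1 := hd.map t ht
  have m2 := hd.map t' ht'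
  have n1 := hd.ne ht
  have n2 := hd.ne ht'
  have l1 := hd.letter t ht
  have l2 := hd.letter t' ht'
  obtain ⟨p, hp⟩ : ∃ p, d t = p := ⟨_, rfl⟩
  obtain ⟨q, hq⟩ : ∃ q, d t' = q := ⟨_, rfl⟩
  rw [hp] at hdt i1 m1 n1 l1
  rw [hq] at hdt' i2 m2 n2 l2
  have hpq : p ≠ q := by grind
  -- The partners `p` of `t` and `q` of `t'` lose their mates and carry inverse letters, so they are
  -- paired with each other; all other pairs are kept.
  let e : w.carrier → w.carrier := fun r => if r = p then q else if r = q then p else d r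
  have ep : e p = q := if_pos rfl
  have eq : e q = p := by simp [e, hpq.symm]
  have eo : ∀ r, r ≠ p → r ≠ q → e r = d r := fun r h1 h2 => by simp [e, h1, h2]
  have mem : ∀ r, r ∈ V \ {t, t'} ↔ r ∈ V ∧ r ≠ t ∧ r ≠ t' := by
    intro r
    simp [not_or]
  clear_value e
  have other : ∀ r ∈ V, r ≠ t → r ≠ t' → r ≠ p → r ≠ q →
      e r = d r ∧ d r ∈ V ∧ d (d r) = r ∧ d r ≠ t ∧ d r ≠ t' ∧ d r ≠ p ∧ d r ≠ q := by
    intro r hr h1 h2 h3 h4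
    have i3 := hd.inv r hr
    refine ⟨eo r h3 h4, hd.map r hr, i3, ?_, ?_, ?_, ?_⟩ <;> intro h5 <;> rw [h5] at i3
    · exact h3 (i3.symm.trans hp)
    · exact h4 (i3.symm.trans hq)
    · exact h1 (i3.symm.trans i1)
    · exact h2 (i3.symm.trans i2)
  -- Since `t` and `t'` are adjacent, the two arcs to `p` and `q` act like a single arc from `p` to
  -- `q`, which no other arc crosses.
  have inner : ∀ r ∈ V, r ≠ t → r ≠ t' → r ≠ p → r ≠ q → p ≤ q → p ≤ r → r ≤ q →
      p ≤ d r ∧ d r ≤ q := by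
    intro r hr h1 h2 h3 h4 h5 h6 h7
    have c1 := hd.noncrossing t ht t' ht'
    have c2 := hd.noncrossing q m2 t ht
    have c3 := hd.noncrossing p m1 r hr
    have c4 := hd.noncrossing t' ht' r hr
    have c5 := hadj p m1
    have c6 := hadj q m2
    have c7 := hadj r hr
    clear other hadj mem eo hd
    grind
  have inner' : ∀ r ∈ V, r ≠ t → r ≠ t' → r ≠ p → r ≠ q → q ≤ p → q ≤ r → r ≤ p →
      q ≤ d r ∧ d r ≤ p := by
    intro r hr h1 h2 h3 h4 h5 h6 h7
    obtain ⟨-, o2, o3, o4, o5, o6, o7⟩ := other r hr h1 h2 h3 h4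
    have c1 := hd.noncrossing p m1 t' ht'
    have c2 := hd.noncrossing q m2 t ht
    have c3 := hd.noncrossing t ht r hr
    have c4 := hd.noncrossing q m2 r hr
    have c5 := hadj p m1
    have c6 := hadj q m2
    have c7 := hadj r hr
    have c8 := hd.noncrossing t' ht' (d r) o2
    have c9 := hd.noncrossing p m1 (d r) o2
    have c10 := hadj (d r) o2
    clear other hadj mem eo hd inner
    grind
  refine ⟨e, ?_, ?_, ?_, ?_⟩
  · intro r hr
    rw [mem] at hr ⊢
    by_cases h1 : r = p
    · rw [h1, ep]
      exact ⟨m2, hdt', n2⟩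
    by_cases h2 : r = q
    · rw [h2, eq]
      exact ⟨m1, n1, hdt⟩
    obtain ⟨h3, h4, -, h5, h6, -⟩ := other r hr.1 hr.2.1 hr.2.2 h1 h2
    rw [h3]
    exact ⟨h4, h5, h6⟩
  · intro r hr
    rw [mem] at hr
    by_cases h1 : r = p
    · rw [h1, ep, eq]
    by_cases h2 : r = q
    · rw [h2, eq, ep]
    obtain ⟨h3, h4, h5, -, -, h6, h7⟩ := other r hr.1 hr.2.1 hr.2.2 h1 h2
    rw [h3, eo _ h6 h7, h5]
  · intro a ha r hr h1 h2
    rw [mem] at ha hr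
    by_cases ha1 : a = p
    · rw [ha1] at h1 h2 ⊢
      rw [ep] at h2 ⊢
      by_cases hr1 : r = p
      · rw [hr1, ep]
        exact ⟨h1.trans h2, le_rfl⟩
      by_cases hr2 : r = q
      · rw [hr2, eq]
        exact ⟨le_rfl, h1.trans h2⟩
      rw [eo r hr1 hr2]
      exact inner r hr.1 hr.2.1 hr.2.2 hr1 hr2 (h1.trans h2) h1 h2
    by_cases ha2 : a = q
    · rw [ha2] at h1 h2 ⊢
      rw [eq] at h2 ⊢
      by_cases hr1 : r = p
      · rw [hr1, ep]
        exact ⟨le_rfl, h1.trans h2⟩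
      by_cases hr2 : r = q
      · rw [hr2, eq]
        exact ⟨h1.trans h2, le_rfl⟩
      rw [eo r hr1 hr2]
      exact inner' r hr.1 hr.2.1 hr.2.2 hr1 hr2 (h1.trans h2) h1 h2
    obtain ⟨o1, o2, o3, o4, o5, o6, o7⟩ := other a ha.1 ha.2.1 ha.2.2 ha1 ha2
    rw [o1] at h2 ⊢
    have nc := hd.noncrossing a ha.1
    have c1 := nc p m1
    have c2 := nc q m2
    have c3 := nc t ht
    have c4 := nc t' ht'
    have ad1 := hadj a ha.1
    have ad2 := hadj (d a) o2
    by_cases hr1 : r = p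
    · rw [hr1] at h1 h2 ⊢
      rw [ep]
      clear other inner inner' hadj mem eo nc hd
      grind
    by_cases hr2 : r = q
    · rw [hr2] at h1 h2 ⊢
      rw [eq]
      clear other inner inner' hadj mem eo nc hd
      grind
    rw [eo r hr1 hr2]
    exact nc r hr.1 h1 h2
  · intro r hr
    rw [mem] at hr
    have l3 := hd.letter r hr.1
    by_cases h1 : r = p
    · rw [h1, ep, l2, hl, l1]
    · by_cases h2 : r = q
      · rw [h2, eq, l1, l2, hl, Letter.inv_inv]
      · rw [eo r h1 h2, l3]

/-- Induction on the size of `C`: an innermost pair of `C` is adjacent in `V`, because `C` contains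
every index of `V` between paired ones, and it can be removed by `Pairable.diff_adjacent`. -/
theorem Pairable.diff_of_finite {c : w.carrier → w.carrier} (n : ℕ) :
    ∀ {V C : Set w.carrier}, C.Finite → C.ncard = n → C ⊆ V → w.PairsOn C c →
      (∀ t ∈ C, ∀ r ∈ V, t ≤ r → r ≤ c t → r ∈ C) → w.Pairable V → w.Pairable (V \ C) := by
  induction n using Nat.strong_induction_on with
  | _ n ih =>
  intro V C hfin hn hCV hc hcomp hV
  rcases C.eq_empty_or_nonempty with rfl | ⟨t₀, ht₀⟩
  · simpa using hV
  have hne : {t ∈ C | t < c t}.Nonempty := by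
    rcases lt_or_gt_of_ne (hc.ne ht₀) with hlt | hlt
    · exact ⟨c t₀, hc.map _ ht₀, by rwa [hc.inv _ ht₀]⟩
    · exact ⟨t₀, ht₀, hlt⟩
  -- A pair enclosing the fewest indices of `C` is innermost: any further index under it would give
  -- a strictly smaller arc.
  obtain ⟨t, ⟨ht, hlt⟩, hmin⟩ := Set.exists_min_image {t ∈ C | t < c t}
    (fun t => (Icc t (c t) ∩ C).ncard) (hfin.subset (sep_subset _ _)) hne
  have ht' := hc.map t ht
  have it := hc.inv t ht
  have hadj : ∀ r ∈ V, t ≤ r → r ≤ c t → r = t ∨ r = c t := by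
    intro r hr h1 h2
    by_contra hcon
    rw [not_or] at hcon
    have hrC := hcomp t ht r hr h1 h2
    have h3 := hc.noncrossing t ht r hrC h1 h2
    have h4 := hc.inv r hrC
    have key : ∀ x ∈ C, t ≤ x → x ≤ c t → t ≤ c x → c x ≤ c t → x ≠ t → c x ≠ t → x < c x →
        False := by
      intro x hx k1 k2 k3 k4 k5 k6 k7
      refine absurd (hmin x ⟨hx, k7⟩) (not_le.2 (Set.ncard_lt_ncard ?_ (hfin.subset inter_subset_right)))
      refine ⟨fun y hy => ⟨⟨k1.trans hy.1.1, hy.1.2.trans k4⟩, hy.2⟩, fun hsub => ?_⟩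
      have := (hsub ⟨⟨le_rfl, hlt.le⟩, ht⟩).1.1
      exact k5 (le_antisymm this k1)
    have h5 : c r ≠ t := fun e => hcon.2 (by rw [← h4, e])
    rcases lt_or_gt_of_ne (hc.ne hrC) with hlt' | hlt'
    · exact key (c r) (hc.map r hrC) h3.1 h3.2 (by rwa [h4]) (by rwa [h4]) h5 (by rw [h4]; exact hcon.1)
        (by rwa [h4])
    · exact key r hrC h1 h2 h3.1 h3.2 hcon.1 h5 hlt'
  have hV' := hV.diff_adjacent (hCV ht) (hCV ht') hlt hadj (hc.letter t ht)
  have hmap' : ∀ r ∈ C \ {t, c t}, c r ∈ C \ {t, c t} := by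
    rintro r ⟨hr, hne⟩
    have i3 := hc.inv r hr
    refine ⟨hc.map r hr, ?_⟩
    simp only [mem_insert_iff, mem_singleton_iff, not_or] at hne ⊢
    exact ⟨fun e => hne.2 (by rw [← i3, e]), fun e => hne.1 (by rw [← i3, e, it])⟩
  have := ih (C \ {t, c t}).ncard
    (hn ▸ Set.ncard_lt_ncard ⟨sdiff_subset, fun hsub => (hsub ht).2 (Or.inl rfl)⟩ hfin)
    (hfin.subset sdiff_subset) rfl (sdiff_subset_sdiff_left hCV) (hc.mono sdiff_subset hmap') ?_ hV'
  · convert this using 1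
    ext r
    simp only [mem_sdiff, mem_insert_iff, mem_singleton_iff]
    constructor
    · rintro ⟨h1, h2⟩
      exact ⟨⟨h1, by rintro (rfl | rfl) <;> contradiction⟩, fun h => h2 h.1⟩
    · rintro ⟨⟨h1, h2⟩, h3⟩
      exact ⟨h1, fun h => h3 ⟨h, h2⟩⟩
  · rintro r ⟨hr, -⟩ s ⟨hs, hs'⟩ h1 h2
    exact ⟨hcomp r hr s hs h1 h2, hs'⟩

/-- The indices of the letters from a set of generators. -/
def indices (w : TransfiniteWord A) (F : Set A) : Set w.carrier := {s | (w.letter s).1 ∈ F}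

theorem finite_indices (w : TransfiniteWord A) {F : Set A} (hF : F.Finite) : (w.indices F).Finite := by
  have : w.indices F ⊆ ⋃ x ∈ F ×ˢ (univ : Set Bool), {s | w.letter s = x} := by
    intro s hs
    simp only [mem_iUnion]
    exact ⟨w.letter s, ⟨hs, mem_univ _⟩, rfl⟩
  exact ((hF.prod finite_univ).biUnion fun x _ => w.finite_fiber x).subset this

theorem PairsOn.inter_indices {V : Set w.carrier} {star : w.carrier → w.carrier}
    (h : w.PairsOn V star) (F : Set A) : w.PairsOn (V ∩ w.indices F) star := by
  refine h.mono inter_subset_left ?_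
  rintro t ⟨ht, hF⟩
  refine ⟨h.map t ht, ?_⟩
  change (w.letter (star t)).1 ∈ F
  rw [h.letter t ht]
  exact hF

/-- A word has a complete cancellation if its restrictions to finite sets of generators do. -/
theorem pairable_of_finite {V : Set w.carrier}
    (h : ∀ F : Finset A, w.Pairable (V ∩ w.indices F)) : w.Pairable V := by
  classical
  choose g hg using h
  -- Compactness: the pairings chosen for the finite sets of generators are combined along an
  -- ultrafilter finer than inclusion.
  let U : Ultrafilter (Finset A) := Ultrafilter.of Filter.atTop
  have hU : ∀ s : w.carrier, ∀ᶠ F : Finset A in U, s ∈ w.indices (F : Set A) := by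
    intro s
    refine (Ultrafilter.of_le Filter.atTop) ?_
    filter_upwards [Filter.eventually_ge_atTop {(w.letter s).1}] with F hF
    exact hF (Finset.mem_singleton_self _)
  have hmem : ∀ s ∈ V, ∀ᶠ F : Finset A in U, s ∈ V ∩ w.indices (F : Set A) := fun s hs => by
    filter_upwards [hU s] with F hF using ⟨hs, hF⟩
  have hex : ∀ s : w.carrier, ∃ r, s ∈ V → ∀ᶠ F in U, g F s = r := by
    intro s
    by_cases hs : s ∈ V
    · have h1 : ∀ᶠ F in U, ∃ r ∈ {r | w.letter r = (w.letter s).inv}, g F s = r := by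
        filter_upwards [hmem s hs] with F hF using ⟨_, (hg F).letter s hF, rfl⟩
      rw [Ultrafilter.eventually_exists_mem_iff (w.finite_fiber _)] at h1
      obtain ⟨r, -, hr⟩ := h1
      exact ⟨r, fun _ => hr⟩
    · exact ⟨s, fun h => absurd h hs⟩
  choose star hstar using hex
  have hmap : ∀ t ∈ V, star t ∈ V := by
    intro t ht
    obtain ⟨F, h1, h2⟩ := ((hstar t ht).and (hmem t ht)).exists
    rw [← h1]
    exact ((hg F).map t h2).1
  refine ⟨star, hmap, ?_, ?_, ?_⟩
  · intro t ht
    obtain ⟨F, h1, h2, h3⟩ := ((hstar t ht).and ((hstar _ (hmap t ht)).and (hmem t ht))).exists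
    rw [← h2, ← h1, (hg F).inv t h3]
  · intro t ht r hr
    obtain ⟨F, h1, h2, h3, h4⟩ := ((hstar t ht).and ((hstar r hr).and
      ((hmem t ht).and (hmem r hr)))).exists
    rw [← h1, ← h2]
    exact (hg F).noncrossing t h3 r h4
  · intro t ht
    obtain ⟨F, h1, h2⟩ := ((hstar t ht).and (hmem t ht)).exists
    rw [← h1]
    exact (hg F).letter t h2

/-- Confluence: a cancellation of a word with a complete cancellation leaves a word with a
complete cancellation. -/
theorem Pairable.compl_support (h : w.Pairable univ) (c : w.Cancellation) :
    w.Pairable c.supportᶜ := by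
  refine pairable_of_finite fun F => ?_
  obtain ⟨d, hd⟩ := h
  have hfin := w.finite_indices F.finite_toSet
  have := Pairable.diff_of_finite (V := univ ∩ w.indices F) (C := c.support ∩ w.indices F) _
    (hfin.subset inter_subset_right) rfl (inter_subset_inter_left _ (subset_univ _))
    (c.pairsOn.inter_indices F)
    (fun t ht r hr h1 h2 => ⟨c.complete t ht.1 ⟨h1, h2⟩, hr.2⟩) ⟨d, hd.inter_indices F⟩
  convert this using 1
  ext s
  simp only [mem_inter_iff, mem_compl_iff, mem_sdiff, mem_univ, true_and]
  tauto

/-- The pairings of the support and of its complement combine without crossing: an arc of `c` that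
crossed an arc of `d` would contain an index outside the support. -/
theorem Cancellation.pairable_univ (c : w.Cancellation) (h : w.Pairable c.supportᶜ) :
    w.Pairable univ := by
  classical
  obtain ⟨d, hd⟩ := h
  have hc := c.pairsOn
  let e : w.carrier → w.carrier := fun t => if t ∈ c.support then c.star t else d t
  have e1 : ∀ t ∈ c.support, e t = c.star t := fun t ht => if_pos ht
  have e2 : ∀ t ∉ c.support, e t = d t := fun t ht => if_neg ht
  refine ⟨e, fun _ _ => mem_univ _, ?_, ?_, ?_⟩
  · intro t _
    by_cases ht : t ∈ c.support
    · rw [e1 t ht, e1 _ (hc.map t ht), hc.inv t ht]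
    · rw [e2 t ht, e2 _ (hd.map t ht), hd.inv t ht]
  · intro t _ r _ h1 h2
    by_cases ht : t ∈ c.support
    · rw [e1 t ht] at h2 ⊢
      have hr := c.complete t ht ⟨h1, h2⟩
      rw [e1 r hr]
      exact hc.noncrossing t ht r hr h1 h2
    · rw [e2 t ht] at h2 ⊢
      by_cases hr : r ∈ c.support
      · rw [e1 r hr]
        constructor
        · by_contra hlt
          rw [not_le] at hlt
          refine ht (c.complete _ (hc.map r hr) ⟨hlt.le, ?_⟩)
          rwa [hc.inv r hr]
        · by_contra hlt
          rw [not_le] at hlt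
          exact hd.map t ht (c.complete r hr ⟨h2, hlt.le⟩)
      · rw [e2 r hr]
        exact hd.noncrossing t ht r hr h1 h2
  · intro t _
    by_cases ht : t ∈ c.support
    · rw [e1 t ht, hc.letter t ht]
    · rw [e2 t ht, hd.letter t ht]

theorem CancelsTo.pairable_univ_iff (h : w.CancelsTo v) :
    w.Pairable univ ↔ v.Pairable univ := by
  obtain ⟨c, f, hf, hl⟩ := h
  rw [← pairable_image_iff f hl, image_univ, hf]
  exact ⟨fun h => h.compl_support c, c.pairable_univ⟩

/-- Complete cancellability is invariant under the generating relation, hence descends to the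
quotient. -/
theorem pairable_univ_iff_of_mk_eq (h : BigFreeGroup.mk w = BigFreeGroup.mk v) :
    w.Pairable univ ↔ v.Pairable univ := by
  let P : BigFreeGroup A → Prop := Quot.lift (fun w => w.Pairable univ)
    (fun _ _ h => propext h.pairable_univ_iff)
  exact iff_of_eq (congrArg P h)

theorem pairable_univ_of_mk_eq_one (h : BigFreeGroup.mk w = 1) : w.Pairable univ :=
  (pairable_univ_iff_of_mk_eq (v := empty A) h).2
    ⟨id, fun t => t.elim, fun t => t.elim, fun t => t.elim, fun t => t.elim⟩

/-! ### Concatenation -/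

/-- The inclusion of the first factor of a concatenation. -/
def inl (w v : TransfiniteWord A) : w.carrier ↪o (w.concat v).carrier :=
  OrderEmbedding.ofMapLEIff (fun s => toLex (Sum.inl s)) fun _ _ => Sum.Lex.inl_le_inl_iff

/-- The inclusion of the second factor of a concatenation. -/
def inr (w v : TransfiniteWord A) : v.carrier ↪o (w.concat v).carrier :=
  OrderEmbedding.ofMapLEIff (fun s => toLex (Sum.inr s)) fun _ _ => Sum.Lex.inr_le_inr_iff

theorem inl_lt_inr (s : w.carrier) (t : v.carrier) : inl w v s < inr w v t := Sum.Lex.inl_lt_inr _ _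

theorem exists_inl_or_inr (s : (w.concat v).carrier) :
    (∃ t, s = inl w v t) ∨ ∃ t, s = inr w v t := by
  rcases s with s | s
  · exact Or.inl ⟨s, rfl⟩
  · exact Or.inr ⟨s, rfl⟩

theorem ordConnected_range_inl : (range (inl w v)).OrdConnected := by
  refine IsLowerSet.ordConnected ?_
  rintro _ s h ⟨t, rfl⟩
  rcases exists_inl_or_inr s with ⟨r, rfl⟩ | ⟨r, rfl⟩
  · exact ⟨r, rfl⟩
  · exact absurd h (not_le.2 (inl_lt_inr _ _))

theorem ordConnected_range_inr : (range (inr w v)).OrdConnected := by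
  refine IsUpperSet.ordConnected ?_
  rintro _ s h ⟨t, rfl⟩
  rcases exists_inl_or_inr s with ⟨r, rfl⟩ | ⟨r, rfl⟩
  · exact absurd h (not_le.2 (inl_lt_inr _ _))
  · exact ⟨r, rfl⟩

/-- A partner within `w` would make an interval of the reduced word `w` cancel, so every arc crosses
the seam of the concatenation. -/
theorem PairsOn.exists_star_inl_eq (hw : w.IsReduced) {V : Set (w.concat v).carrier}
    (hV : V.OrdConnected) {star : (w.concat v).carrier → (w.concat v).carrier}
    (h : (w.concat v).PairsOn V star) {s : w.carrier} (hs : inl w v s ∈ V) :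
    ∃ t, star (inl w v s) = inr w v t := by
  rcases exists_inl_or_inr (star (inl w v s)) with ⟨r, hr⟩ | hr
  · exact absurd hr (h.not_mem_range hw (inl w v) (fun _ => rfl) ordConnected_range_inl hV hs)
  · exact hr

theorem PairsOn.exists_star_inr_eq (hv : v.IsReduced) {V : Set (w.concat v).carrier}
    (hV : V.OrdConnected) {star : (w.concat v).carrier → (w.concat v).carrier}
    (h : (w.concat v).PairsOn V star) {s : v.carrier} (hs : inr w v s ∈ V) :
    ∃ t, star (inr w v s) = inl w v t := by
  rcases exists_inl_or_inr (star (inr w v s)) with hr | ⟨r, hr⟩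
  · exact hr
  · exact absurd hr (h.not_mem_range hv (inr w v) (fun _ => rfl) ordConnected_range_inr hV hs)

/-- The number of occurrences of a generator and its inverse. -/
noncomputable def count (w : TransfiniteWord A) (a : A) : ℕ := {s | (w.letter s).1 = a}.ncard

theorem finite_count (w : TransfiniteWord A) (a : A) : {s | (w.letter s).1 = a}.Finite :=
  w.finite_indices (finite_singleton a)

theorem count_concat (w v : TransfiniteWord A) (a : A) :
    (w.concat v).count a = w.count a + v.count a := by
  have e : {s | ((w.concat v).letter s).1 = a} =
      inl w v '' {s | (w.letter s).1 = a} ∪ inr w v '' {s | (v.letter s).1 = a} := by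
    ext s
    constructor
    · intro hs
      rcases exists_inl_or_inr s with ⟨r, rfl⟩ | ⟨r, rfl⟩
      · exact Or.inl ⟨r, hs, rfl⟩
      · exact Or.inr ⟨r, hs, rfl⟩
    · rintro (⟨r, hr, rfl⟩ | ⟨r, hr, rfl⟩)
      · exact hr
      · exact hr
  rw [count, e, ncard_union_eq ?_ ((w.finite_count a).image _) ((v.finite_count a).image _),
    ncard_image_of_injective _ (inl w v).injective, ncard_image_of_injective _ (inr w v).injective,
    count, count]
  rw [Set.disjoint_left]
  rintro _ ⟨r, -, rfl⟩ ⟨s, -, e⟩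
  exact (inl_lt_inr r s).ne e.symm

theorem count_inverse (w : TransfiniteWord A) (a : A) : w.inverse.count a = w.count a := rfl

theorem count_le_of_embedding (f : v.carrier → w.carrier) (hf : Function.Injective f)
    (hl : ∀ s, (w.letter (f s)).1 = (v.letter s).1) (a : A) : v.count a ≤ w.count a := by
  refine ncard_le_ncard_of_injOn f (fun s hs => ?_) hf.injOn (w.finite_count a)
  change (w.letter (f s)).1 = a
  rw [hl]
  exact hs

/-- The word `w⁻¹v` cancels completely. As `w⁻¹` is reduced, each of its letters is paired with a
letter of `v`, which gives an injection respecting generators. The length function needs only these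
counts, not an isomorphism of reduced words. -/
theorem IsReduced.count_le_of_mk_eq (hw : w.IsReduced) (h : BigFreeGroup.mk w = BigFreeGroup.mk v)
    (a : A) : w.count a ≤ v.count a := by
  have h1 : BigFreeGroup.mk (w.inverse.concat v) = 1 := by
    change (BigFreeGroup.mk w)⁻¹ * BigFreeGroup.mk v = 1
    rw [h, inv_mul_cancel]
  obtain ⟨star, hs⟩ := pairable_univ_of_mk_eq_one h1
  have h2 : ∀ s : w.inverse.carrier, ∃ t, star (inl _ v s) = inr _ v t := fun s =>
    hs.exists_star_inl_eq hw.inverse ordConnected_univ (mem_univ _)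
  choose f hf using h2
  rw [← count_inverse]
  refine count_le_of_embedding f (fun s t e => ?_) (fun s => ?_) a
  · apply (inl w.inverse v).injective
    rw [← hs.inv (inl _ v s) (mem_univ _), hf s, e, ← hf t, hs.inv _ (mem_univ _)]
  · have := hs.letter (inl _ v s) (mem_univ _)
    rw [hf s] at this
    have h3 : v.letter (f s) = (w.inverse.letter s).inv := this
    rw [h3]
    rfl

variable {p q : TransfiniteWord A}

theorem IsReduced.count_eq_of_mk_eq (hw : w.IsReduced) (hv : v.IsReduced)
    (h : BigFreeGroup.mk w = BigFreeGroup.mk v) (a : A) : w.count a = v.count a :=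
  le_antisymm (hw.count_le_of_mk_eq h a) (hv.count_le_of_mk_eq h.symm a)

/-- A matching of an initial segment of `w` with an initial segment of `v`, as words. -/
structure Matching (R : w.carrier → v.carrier → Prop) : Prop where
  lt_iff : ∀ {s s' t t'}, R s t → R s' t' → (s < s' ↔ t < t')
  lower_left : ∀ {s s' t}, R s t → s' ≤ s → ∃ t', R s' t'
  lower_right : ∀ {s t t'}, R s t → t' ≤ t → ∃ s', R s' t'
  letter : ∀ {s t}, R s t → v.letter t = w.letter s

theorem Matching.flip {R : w.carrier → v.carrier → Prop} (h : Matching R) :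
    Matching (fun t s => R s t) :=
  ⟨fun h1 h2 => (h.lt_iff h1 h2).symm, h.lower_right, h.lower_left, fun h1 => (h.letter h1).symm⟩

theorem Matching.eq_iff {R : w.carrier → v.carrier → Prop} (h : Matching R) {s s' t t'}
    (h1 : R s t) (h2 : R s' t') : s = s' ↔ t = t' := by
  have := h.lt_iff h1 h2
  have := h.lt_iff h2 h1
  grind

/-- A matching carries the occurrences of a letter up to `s` injectively to those up to `t`. With
the flipped inequality, `t` has the same finite ordinal among the occurrences of its letter as `s`.
-/
theorem Matching.ncard_le {R : w.carrier → v.carrier → Prop} (h : Matching R) {s t} (hst : R s t) :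
    {r | r ≤ s ∧ w.letter r = w.letter s}.ncard ≤ {r | r ≤ t ∧ v.letter r = w.letter s}.ncard := by
  have h1 : ∀ r, ∃ y, r ≤ s → R r y := fun r => by
    by_cases hr : r ≤ s
    · obtain ⟨y, hy⟩ := h.lower_left hst hr
      exact ⟨y, fun _ => hy⟩
    · exact ⟨t, fun h => absurd h hr⟩
  choose f hf using h1
  refine ncard_le_ncard_of_injOn f ?_ ?_ ((v.finite_fiber _).subset fun r hr => hr.2)
  · rintro r ⟨h1, h2⟩
    refine ⟨?_, (h.letter (hf r h1)).trans h2⟩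
    have := h.lt_iff hst (hf r h1)
    exact not_lt.1 fun hlt => absurd h1 (not_le.2 (this.2 hlt))
  · rintro r ⟨h1, -⟩ r' ⟨h2, -⟩ e
    exact (h.eq_iff (hf r h1) (hf r' h2)).2 e

/-- Matchings are unique, because the fibres of a word are finite. -/
theorem Matching.unique {R R' : w.carrier → v.carrier → Prop} (h : Matching R) (h' : Matching R')
    {s t t'} (h1 : R s t) (h2 : R' s t') : t = t' := by
  have e1 := le_antisymm (h.ncard_le h1) (by
    have := h.flip.ncard_le h1
    rwa [h.letter h1] at this)
  have e2 := le_antisymm (h'.ncard_le h2) (by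
    have := h'.flip.ncard_le h2
    rwa [h'.letter h2] at this)
  -- Distinct occurrences of one letter have different numbers of occurrences up to them, so the
  -- number determines the index.
  have key : ∀ t t' : v.carrier, v.letter t' = w.letter s → t < t' →
      {r | r ≤ t ∧ v.letter r = w.letter s}.ncard < {r | r ≤ t' ∧ v.letter r = w.letter s}.ncard := by
    intro t t' hl hlt
    refine ncard_lt_ncard ⟨fun r hr => ⟨hr.1.trans hlt.le, hr.2⟩, fun hsub => ?_⟩
      ((v.finite_fiber _).subset fun r hr => hr.2)
    exact absurd (hsub ⟨le_rfl, hl⟩).1 (not_le.2 hlt)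
  rcases lt_trichotomy t t' with hlt | e | hlt
  · exact absurd (e1.symm.trans e2) (key t t' (h'.letter h2) hlt).ne
  · exact e
  · exact absurd (e2.symm.trans e1) (key t' t (h.letter h1) hlt).ne

/-- There is a largest matching. -/
theorem exists_matching_max (w v : TransfiniteWord A) :
    ∃ R : w.carrier → v.carrier → Prop, Matching R ∧
      ∀ R' : w.carrier → v.carrier → Prop, Matching R' → ∀ s t, R' s t → R s t := by
  -- The union of all matchings is again a matching, since any two agree wherever both are defined.
  refine ⟨fun s t => ∃ R : w.carrier → v.carrier → Prop, Matching R ∧ R s t,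
    ⟨?_, ?_, ?_, ?_⟩, fun R hR s t h => ⟨R, hR, h⟩⟩
  · rintro s s' t t' ⟨R, hR, h1⟩ ⟨R', hR', h2⟩
    constructor
    · intro hlt
      obtain ⟨t₁, h3⟩ := hR'.lower_left h2 hlt.le
      rw [hR.unique hR' h1 h3]
      exact (hR'.lt_iff h3 h2).1 hlt
    · intro hlt
      obtain ⟨s₁, h3⟩ := hR'.lower_right h2 hlt.le
      rw [hR.flip.unique hR'.flip h1 h3]
      exact (hR'.lt_iff h3 h2).2 hlt
  · rintro s s' t ⟨R, hR, h1⟩ hle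
    obtain ⟨t', h2⟩ := hR.lower_left h1 hle
    exact ⟨t', R, hR, h2⟩
  · rintro s t t' ⟨R, hR, h1⟩ hle
    obtain ⟨t', h2⟩ := hR.lower_right h1 hle
    exact ⟨t', R, hR, h2⟩
  · rintro s t ⟨R, hR, h1⟩
    exact hR.letter h1

/-- What remains of two reduced words `w`, `v` after their largest common initial segment are
words `w'`, `v'` such that `w'⁻¹ v'` is reduced. -/
theorem Matching.isReduced (hw : w.IsReduced) (hv : v.IsReduced)
    {R : w.carrier → v.carrier → Prop} (hR : Matching R)
    (hmax : ∀ R' : w.carrier → v.carrier → Prop, Matching R' → ∀ s t, R' s t → R s t) :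
    ((w.restrict {s | ∃ t, R s t}ᶜ).inverse.concat
      (v.restrict {t | ∃ s, R s t}ᶜ)).IsReduced := by
  set P := {s | ∃ t, R s t} with hP
  set Q := {t | ∃ s, R s t} with hQ
  have lP : IsLowerSet P := by
    rintro s s' hle ⟨t, ht⟩
    exact hR.lower_left ht hle
  have lQ : IsLowerSet Q := by
    rintro s s' hle ⟨t, ht⟩
    exact hR.lower_right ht hle
  have hw1 : (w.restrict Pᶜ).IsReduced := by
    refine hw.of_ordConnected (OrderEmbedding.subtype _) (fun _ => rfl) ?_
    exact (Subtype.range_coe (s := Pᶜ)).symm ▸ lP.compl.ordConnected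
  have hv1 : (v.restrict Qᶜ).IsReduced := by
    refine hv.of_ordConnected (OrderEmbedding.subtype _) (fun _ => rfl) ?_
    exact (Subtype.range_coe (s := Qᶜ)).symm ▸ lQ.compl.ordConnected
  rw [isReduced_iff]
  rintro a b hab ⟨star, hs⟩
  let i : ∀ s, s ∉ P → ((w.restrict Pᶜ).inverse.concat (v.restrict Qᶜ)).carrier :=
    fun s hs => inl _ _ (OrderDual.toDual ⟨s, hs⟩)
  let j : ∀ t, t ∉ Q → ((w.restrict Pᶜ).inverse.concat (v.restrict Qᶜ)).carrier :=
    fun t ht => inr _ _ ⟨t, ht⟩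
  have ile : ∀ s s' hs hs', i s hs ≤ i s' hs' ↔ s' ≤ s := fun s s' hs hs' =>
    (inl (w.restrict Pᶜ).inverse (v.restrict Qᶜ)).le_iff_le
  have jle : ∀ s s' hs hs', j s hs ≤ j s' hs' ↔ s ≤ s' := fun s s' hs hs' =>
    (inr (w.restrict Pᶜ).inverse (v.restrict Qᶜ)).le_iff_le
  have ij : ∀ s t hs ht, i s hs < j t ht := fun s t hs ht => inl_lt_inr _ _
  have si : ∀ s hs, i s hs ∈ Icc a b → ∃ t ht, star (i s hs) = j t ht := by
    intro s hsP hm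
    obtain ⟨t, ht⟩ := hs.exists_star_inl_eq hw1.inverse ordConnected_Icc hm
    exact ⟨t.1, t.2, ht⟩
  have sj : ∀ t ht, j t ht ∈ Icc a b → ∃ s hs, star (j t ht) = i s hs := by
    intro t htQ hm
    obtain ⟨s, hs⟩ := hs.exists_star_inr_eq hv1 ordConnected_Icc hm
    exact ⟨(OrderDual.ofDual s).1, (OrderDual.ofDual s).2, hs⟩
  have letter : ∀ s t hs' ht, i s hs' ∈ Icc a b → star (i s hs') = j t ht →
      v.letter t = w.letter s := by
    intro s t hs' ht hm e
    have := hs.letter _ hm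
    rw [e] at this
    exact this.trans (Letter.inv_inv _)
  -- A pairing of an interval `[a, b]` of `w'⁻¹v'` joins `w'` to `v'`; adding its arcs to `R` gives
  -- a larger matching.
  let R' : w.carrier → v.carrier → Prop := fun s t =>
    R s t ∨ ∃ hs ht, i s hs ∈ Icc a b ∧ star (i s hs) = j t ht
  -- Arcs across the seam are nested. Since the first factor is order-reversed, nesting means that
  -- the correspondence preserves order.
  have hle : ∀ s t s' t' hs ht hs' ht', i s hs ∈ Icc a b → i s' hs' ∈ Icc a b →
      star (i s hs) = j t ht → star (i s' hs') = j t' ht' → s ≤ s' → t ≤ t' := by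
    intro s t s' t' hs1 ht1 hs2 ht2 m1 m2 e1 e2 hle
    have := hs.noncrossing _ m2 _ m1 ((ile _ _ _ _).2 hle) (by rw [e2]; exact (ij _ _ _ _).le)
    rw [e1, e2, jle] at this
    exact this.2
  have hinj : ∀ s t s' t' hs ht hs' ht', i s hs ∈ Icc a b → i s' hs' ∈ Icc a b →
      star (i s hs) = j t ht → star (i s' hs') = j t' ht' → t = t' → s = s' := by
    intro s t s' t' hs1 ht1 hs2 ht2 m1 m2 e1 e2 e
    subst e
    have e3 : i s hs1 = i s' hs2 := by rw [← hs.inv _ m1, e1, ← e2, hs.inv _ m2]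
    exact le_antisymm ((ile _ _ _ _).1 e3.ge) ((ile _ _ _ _).1 e3.le)
  have hR' : Matching R' := by
    refine ⟨?_, ?_, ?_, ?_⟩
    · rintro s s' t t' (h1 | ⟨hs1, ht1, m1, e1⟩) (h2 | ⟨hs2, ht2, m2, e2⟩)
      · exact hR.lt_iff h1 h2
      · refine iff_of_true (not_le.1 fun hle => hs2 (lP hle ⟨t, h1⟩))
          (not_le.1 fun hle => ht2 (lQ hle ⟨s, h1⟩))
      · refine iff_of_false (not_lt.2 <| le_of_not_ge fun hle => hs1 (lP hle ⟨t', h2⟩))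
          (not_lt.2 <| le_of_not_ge fun hle => ht1 (lQ hle ⟨s', h2⟩))
      · constructor
        · intro hlt
          refine (hle s t s' t' hs1 ht1 hs2 ht2 m1 m2 e1 e2 hlt.le).lt_of_ne fun e => hlt.ne ?_
          exact hinj s t s' t' hs1 ht1 hs2 ht2 m1 m2 e1 e2 e
        · intro hlt
          by_contra hcon
          exact absurd (hle s' t' s t hs2 ht2 hs1 ht1 m2 m1 e2 e1 (not_lt.1 hcon)) (not_le.2 hlt)
    · rintro s s' t (h1 | ⟨hs1, ht1, m1, e1⟩) hle
      · obtain ⟨t', h2⟩ := hR.lower_left h1 hle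
        exact ⟨t', Or.inl h2⟩
      · by_cases hs' : s' ∈ P
        · obtain ⟨t', h2⟩ := hs'
          exact ⟨t', Or.inl h2⟩
        · have m3 := hs.map _ m1
          rw [e1] at m3
          -- Going down in `w'` moves towards the seam, which lies between the two ends of an arc,
          -- so `[a, b]` is not left.
          have m2 : i s' hs' ∈ Icc a b :=
            ⟨m1.1.trans ((ile _ _ _ _).2 hle), (ij _ _ _ _).le.trans m3.2⟩
          obtain ⟨t', ht', e2⟩ := si s' hs' m2
          exact ⟨t', Or.inr ⟨hs', ht', m2, e2⟩⟩
    · rintro s t t' (h1 | ⟨hs1, ht1, m1, e1⟩) hle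
      · obtain ⟨t', h2⟩ := hR.lower_right h1 hle
        exact ⟨t', Or.inl h2⟩
      · by_cases ht' : t' ∈ Q
        · obtain ⟨s', h2⟩ := ht'
          exact ⟨s', Or.inl h2⟩
        · have m3 := hs.map _ m1
          rw [e1] at m3
          have m2 : j t' ht' ∈ Icc a b :=
            ⟨m1.1.trans (ij _ _ _ _).le, ((jle _ _ _ _).2 hle).trans m3.2⟩
          obtain ⟨s', hs', e2⟩ := sj t' ht' m2
          refine ⟨s', Or.inr ⟨hs', ht', ?_, ?_⟩⟩
          · rw [← e2]
            exact hs.map _ m2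
          · rw [← e2, hs.inv _ m2]
    · rintro s t (h1 | ⟨hs1, ht1, m1, e1⟩)
      · exact hR.letter h1
      · exact letter s t hs1 ht1 m1 e1
  have ha : a ∈ Icc a b := ⟨le_rfl, hab⟩
  -- If `a` is in the first factor, its arc violates maximality of `R`; in the second factor, its
  -- partner would precede the left end `a` of the interval.
  rcases exists_inl_or_inr a with ⟨s, rfl⟩ | ⟨t, rfl⟩
  · obtain ⟨t, ht, e⟩ := si (OrderDual.ofDual s).1 (OrderDual.ofDual s).2 ha
    exact (OrderDual.ofDual s).2 ⟨t, hmax R' hR' _ t (Or.inr ⟨(OrderDual.ofDual s).2, ht, ha, e⟩)⟩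
  · obtain ⟨s, hs', e⟩ := sj t.1 t.2 ha
    have := (hs.map _ ha).1
    have h2 : star (inr (w.restrict Pᶜ).inverse (v.restrict Qᶜ) t) = i s hs' := e
    rw [h2] at this
    exact absurd this (not_le.2 (ij s t.1 hs' t.2))

/-! ### Initial segments -/

/-- `p` is isomorphic to an initial segment of `w`. -/
def IsPrefix (p w : TransfiniteWord A) : Prop :=
  ∃ i : p.carrier ↪o w.carrier, IsLowerSet (range i) ∧ ∀ s, w.letter (i s) = p.letter s

/-- The isomorphism of a word with the concatenation of an initial segment and the remainder. -/
theorem exists_orderIso_concat (i : p.carrier ↪o w.carrier) (hi : IsLowerSet (range i))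
    (hl : ∀ s, w.letter (i s) = p.letter s) {S : Set w.carrier} (hS : range i = Sᶜ) :
    ∃ e : (p.concat (w.restrict S)).carrier ≃o w.carrier,
      ∀ s, w.letter (e s) = (p.concat (w.restrict S)).letter s := by
  let f : (p.concat (w.restrict S)).carrier → w.carrier :=
    fun s => Sum.elim i Subtype.val (ofLex s)
  have hf : StrictMono f := by
    intro s t hst
    rcases s with s | s <;> rcases t with t | t
    · exact i.strictMono (Sum.Lex.inl_lt_inl_iff.1 hst)
    · change i s < t.1
      refine not_le.1 fun hle => ?_
      have : t.1 ∈ Sᶜ := hS ▸ hi hle ⟨s, rfl⟩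
      exact this t.2
    · exact absurd hst Sum.Lex.not_inr_lt_inl
    · have h : s < t := Sum.Lex.inr_lt_inr_iff.1 hst
      exact h
  have hsurj : Function.Surjective f := by
    intro s
    by_cases hs : s ∈ S
    · exact ⟨toLex (Sum.inr ⟨s, hs⟩), rfl⟩
    · have : s ∈ range i := hS ▸ hs
      obtain ⟨r, rfl⟩ := this
      exact ⟨toLex (Sum.inl r), rfl⟩
  refine ⟨hf.orderIsoOfSurjective f hsurj, ?_⟩
  intro s
  rcases s with s | s
  · exact hl s
  · rfl

theorem mk_eq_of_orderIso (e : v.carrier ≃o w.carrier) (h : ∀ s, w.letter (e s) = v.letter s) :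
    BigFreeGroup.mk w = BigFreeGroup.mk v :=
  Quot.sound (cancelsTo_of_orderIso e h)

theorem count_eq_of_orderIso (e : v.carrier ≃o w.carrier) (h : ∀ s, w.letter (e s) = v.letter s)
    (a : A) : w.count a = v.count a := by
  refine le_antisymm (count_le_of_embedding e.symm e.symm.injective (fun s => ?_) a)
    (count_le_of_embedding e e.injective (fun s => by rw [h s]) a)
  rw [← h, e.apply_symm_apply]

theorem mk_concat (w v : TransfiniteWord A) :
    BigFreeGroup.mk (w.concat v) = BigFreeGroup.mk w * BigFreeGroup.mk v := rfl

theorem mk_inverse (w : TransfiniteWord A) :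
    BigFreeGroup.mk w.inverse = (BigFreeGroup.mk w)⁻¹ := rfl

/-- With `w = p w'` and `v = p v'`, the prefix cancels in `w⁻¹v`, leaving `w'⁻¹v'`; the letters of
`p` are counted once in each word. -/
theorem mk_inv_mul_mk (i : p.carrier ↪o w.carrier) (hi : IsLowerSet (range i))
    (hl : ∀ s, w.letter (i s) = p.letter s) {S : Set w.carrier} (hS : range i = Sᶜ)
    (j : p.carrier ↪o v.carrier) (hj : IsLowerSet (range j))
    (hl' : ∀ s, v.letter (j s) = p.letter s) {T : Set v.carrier} (hT : range j = Tᶜ) :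
    BigFreeGroup.mk ((w.restrict S).inverse.concat (v.restrict T)) =
        (BigFreeGroup.mk w)⁻¹ * BigFreeGroup.mk v ∧
      ∀ a, ((w.restrict S).inverse.concat (v.restrict T)).count a + 2 * p.count a =
        w.count a + v.count a := by
  obtain ⟨e, he⟩ := exists_orderIso_concat i hi hl hS
  obtain ⟨f, hf⟩ := exists_orderIso_concat j hj hl' hT
  constructor
  · rw [mk_eq_of_orderIso e he, mk_eq_of_orderIso f hf, mk_concat, mk_concat, mk_concat,
      mk_inverse]
    group
  · intro a
    rw [count_eq_of_orderIso e he, count_eq_of_orderIso f hf, count_concat, count_concat,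
      count_concat, count_inverse]
    ring

end TransfiniteWord

namespace BigFreeGroup

variable {A : Type u}

/-- The number of occurrences of a generator and its inverse in the reduced form. -/
noncomputable def count (g : BigFreeGroup A) (a : A) : ℕ := g.reducedForm.count a

theorem reducedForm_isReduced (g : BigFreeGroup A) : g.reducedForm.IsReduced :=
  g.exists_reduced_rep.choose_spec.1

theorem mk_reducedForm (g : BigFreeGroup A) : mk g.reducedForm = g :=
  g.exists_reduced_rep.choose_spec.2

theorem count_mk {w : TransfiniteWord A} (hw : w.IsReduced) (a : A) :
    (mk w).count a = w.count a :=
  (reducedForm_isReduced _).count_eq_of_mk_eq hw (mk_reducedForm _) a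

/-- Reducing a word only deletes letters. -/
theorem count_mk_le (w : TransfiniteWord A) (a : A) : (mk w).count a ≤ w.count a := by
  obtain ⟨v, hv, h⟩ := w.exists_reduced
  have e : mk w = mk v := Quot.sound h
  rw [e, count_mk hv]
  obtain ⟨c, f, -, hl⟩ := h
  exact TransfiniteWord.count_le_of_embedding f f.injective (fun s => by rw [hl s]) a

end BigFreeGroup

namespace TransfiniteWord

variable {A : Type u} {w v p q : TransfiniteWord A}

/-- An arbitrary common prefix bounds the overlap from below, since the remaining word may still
cancel; `IsReduced.exists_isPrefix` gives equality for a suitable prefix. -/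
theorem IsPrefix.count_add_le (hw : p.IsPrefix w) (hv : p.IsPrefix v) (a : A) :
    ((BigFreeGroup.mk w)⁻¹ * BigFreeGroup.mk v).count a + 2 * p.count a ≤
      w.count a + v.count a := by
  obtain ⟨i, hi, hl⟩ := hw
  obtain ⟨j, hj, hl'⟩ := hv
  obtain ⟨h1, h2⟩ := mk_inv_mul_mk i hi hl (compl_compl _).symm j hj hl' (compl_compl _).symm
  rw [← h1, ← h2 a]
  exact Nat.add_le_add_right (BigFreeGroup.count_mk_le _ a) _

/-- Two reduced words have a common initial segment `p` such that their quotient is obtained by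
removing `p` from both. -/
theorem IsReduced.exists_isPrefix (hw : w.IsReduced) (hv : v.IsReduced) :
    ∃ p : TransfiniteWord A, p.IsPrefix w ∧ p.IsPrefix v ∧
      ∀ a, ((BigFreeGroup.mk w)⁻¹ * BigFreeGroup.mk v).count a + 2 * p.count a =
        w.count a + v.count a := by
  obtain ⟨R, hR, hmax⟩ := exists_matching_max w v
  have hred := hR.isReduced hw hv hmax
  let P := {s | ∃ t, R s t}
  have h1 : ∀ s : (w.restrict P).carrier, ∃ t, R s.1 t := fun s => s.2
  choose f hf using h1
  let i : (w.restrict P).carrier ↪o w.carrier := OrderEmbedding.subtype _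
  let j : (w.restrict P).carrier ↪o v.carrier := OrderEmbedding.ofStrictMono f fun s s' hlt =>
    (hR.lt_iff (hf s) (hf s')).1 hlt
  have ri : range i = P := Subtype.range_coe
  have rj : range j = {t | ∃ s, R s t} := by
    ext t
    constructor
    · rintro ⟨s, rfl⟩
      exact ⟨s.1, hf s⟩
    · rintro ⟨s, hs⟩
      exact ⟨⟨s, t, hs⟩, (hR.eq_iff (hf ⟨s, t, hs⟩) hs).1 rfl⟩
  have hi : IsLowerSet (range i) := by
    rw [ri]
    rintro s s' hle ⟨t, ht⟩
    exact hR.lower_left ht hle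
  have hj : IsLowerSet (range j) := by
    rw [rj]
    rintro s s' hle ⟨t, ht⟩
    exact hR.lower_right ht hle
  have hl : ∀ s, w.letter (i s) = (w.restrict P).letter s := fun _ => rfl
  have hl' : ∀ s, v.letter (j s) = (w.restrict P).letter s := fun s => hR.letter (hf s)
  refine ⟨w.restrict P, ⟨i, hi, hl⟩, ⟨j, hj, hl'⟩, fun a => ?_⟩
  obtain ⟨h1, h2⟩ := mk_inv_mul_mk i hi hl (ri.trans (compl_compl _).symm) j hj hl'
    (rj.trans (compl_compl _).symm)
  rw [← h1, ← h2 a, BigFreeGroup.count_mk hred]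

theorem IsPrefix.trans (h : p.IsPrefix q) (h' : q.IsPrefix w) : p.IsPrefix w := by
  obtain ⟨i, hi, hl⟩ := h
  obtain ⟨j, hj, hl'⟩ := h'
  refine ⟨i.trans j, ?_, fun s => (hl' _).trans (hl s)⟩
  rintro _ s hle ⟨t, rfl⟩
  obtain ⟨r, rfl⟩ := hj hle ⟨i t, rfl⟩
  obtain ⟨x, rfl⟩ := hi (j.le_iff_le.1 hle) ⟨t, rfl⟩
  exact ⟨x, rfl⟩

/-- Lower sets of a total order are nested. This is the source of hyperbolicity. -/
theorem IsPrefix.total (h : p.IsPrefix w) (h' : q.IsPrefix w) : p.IsPrefix q ∨ q.IsPrefix p := by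
  have key : ∀ {p q : TransfiniteWord A} (i : p.carrier ↪o w.carrier)
      (j : q.carrier ↪o w.carrier), IsLowerSet (range i) → (∀ s, w.letter (i s) = p.letter s) →
      (∀ s, w.letter (j s) = q.letter s) → range i ⊆ range j → p.IsPrefix q := by
    intro p q i j hi hl hl' hsub
    have h1 : ∀ s, ∃ t, j t = i s := fun s => hsub ⟨s, rfl⟩
    choose f hf using h1
    refine ⟨OrderEmbedding.ofMapLEIff f fun s t => ?_, ?_, fun s => ?_⟩
    · rw [← j.le_iff_le, hf, hf, i.le_iff_le]
    · rintro _ t hle ⟨s, rfl⟩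
      have h2 : j t ≤ i s := by
        rw [← hf]
        exact j.le_iff_le.2 hle
      obtain ⟨r, hr⟩ := hi h2 ⟨s, rfl⟩
      refine ⟨r, j.injective ?_⟩
      rw [← hr]
      exact hf r
    · rw [← hl', ← hl]
      exact congrArg w.letter (hf s)
  obtain ⟨i, hi, hl⟩ := h
  obtain ⟨j, hj, hl'⟩ := h'
  rcases hi.total hj with hsub | hsub
  · exact Or.inl (key i j hi hl hl' hsub)
  · exact Or.inr (key j i hj hl' hl hsub)

end TransfiniteWord

theorem le_of_add_self_add_le {Λ : Type*} [AddCommGroup Λ] [LinearOrder Λ] [IsOrderedAddMonoid Λ]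
    {p c l m n : Λ} (h1 : p + p + l ≤ m + n) (h2 : c + c = m + n - l) : p ≤ c := by
  grind

namespace BigFreeGroup

variable {A : Type u}

/-! ### The length function -/

theorem ofLex_length (g : BigFreeGroup A) (a : A) : ofLex g.length a = (g.count a : ℝ) := by
  simp only [length, IntPow.toReal, lengthZ, ofLex_toLex, Int.cast_natCast]
  rfl

theorem length_eq_add_iff {g h k : BigFreeGroup A} :
    g.length = h.length + k.length ↔ ∀ a, g.count a = h.count a + k.count a := by
  constructor
  · intro e a
    have := congrFun (congrArg ofLex e) a
    rw [ofLex_add, Pi.add_apply, ofLex_length, ofLex_length, ofLex_length] at this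
    exact_mod_cast this
  · intro h
    apply ofLex_inj.1
    funext a
    rw [ofLex_add, Pi.add_apply, ofLex_length, ofLex_length, ofLex_length, h a]
    push_cast
    rfl

theorem mk_eq_one_of_isEmpty (w : TransfiniteWord A) [IsEmpty w.carrier] : mk w = 1 :=
  TransfiniteWord.mk_eq_of_orderIso (v := TransfiniteWord.empty A)
    ⟨Equiv.equivOfIsEmpty PEmpty w.carrier, fun {a} => a.elim⟩ fun s => s.elim

theorem count_one (a : A) : (1 : BigFreeGroup A).count a = 0 := by
  have h := count_mk_le (TransfiniteWord.empty A) a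
  have e : (TransfiniteWord.empty A).count a = 0 := by
    have : {s | ((TransfiniteWord.empty A).letter s).1 = a} = ∅ :=
      eq_empty_iff_forall_notMem.2 fun s => s.elim
    rw [TransfiniteWord.count, this, ncard_empty]
  rw [e] at h
  exact Nat.le_zero.1 h

theorem eq_one_of_count {g : BigFreeGroup A} (h : ∀ a, g.count a = 0) : g = 1 := by
  have : IsEmpty g.reducedForm.carrier := by
    refine ⟨fun s => ?_⟩
    have h1 := h (g.reducedForm.letter s).1
    rw [count, TransfiniteWord.count, ncard_eq_zero (g.reducedForm.finite_count _)] at h1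
    exact (h1 ▸ (rfl : (g.reducedForm.letter s).1 = (g.reducedForm.letter s).1) :
      s ∈ (∅ : Set g.reducedForm.carrier))
  rw [← mk_reducedForm g, mk_eq_one_of_isEmpty]

theorem count_inv (g : BigFreeGroup A) (a : A) : g⁻¹.count a = g.count a := by
  have e : g⁻¹ = mk g.reducedForm.inverse := by
    rw [TransfiniteWord.mk_inverse, mk_reducedForm]
  rw [e, count_mk g.reducedForm_isReduced.inverse, TransfiniteWord.count_inverse]
  rfl

theorem count_mul_le (g h : BigFreeGroup A) (a : A) :
    (g * h).count a ≤ g.count a + h.count a := by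
  have := count_mk_le (g.reducedForm.concat h.reducedForm) a
  rwa [TransfiniteWord.mk_concat, mk_reducedForm, mk_reducedForm,
    TransfiniteWord.count_concat] at this

theorem isReduced_single (x : Letter A) : (TransfiniteWord.single x).IsReduced := by
  rw [TransfiniteWord.isReduced_iff]
  rintro a b hab ⟨star, hs⟩
  exact hs.ne ⟨le_rfl, hab⟩ rfl

theorem count_ofLetter (x : Letter A) (a : A) [Decidable (a = x.1)] :
    (ofLetter x).count a = if a = x.1 then 1 else 0 := by
  rw [ofLetter, count_mk (isReduced_single x), TransfiniteWord.count]
  split_ifs with h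
  · have : {s | ((TransfiniteWord.single x).letter s).1 = a} = {PUnit.unit} := by
      ext s
      exact iff_of_true h.symm rfl
    rw [this]
    exact ncard_singleton PUnit.unit
  · have : {s | ((TransfiniteWord.single x).letter s).1 = a} = ∅ := by
      ext s
      exact iff_of_false (fun e => h e.symm) id
    rw [this, ncard_empty]

theorem ofLetter_inv (x : Letter A) : ofLetter x.inv = (ofLetter x)⁻¹ :=
  TransfiniteWord.mk_eq_of_orderIso (v := (TransfiniteWord.single x).inverse)
    (w := TransfiniteWord.single x.inv) ⟨Equiv.refl _, Iff.rfl⟩ fun _ => rfl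

theorem length_ofLetter_inv (x : Letter A) : (ofLetter x.inv).length = (ofLetter x).length := by
  apply ofLex_inj.1
  funext a
  rw [ofLex_length, ofLex_length, ofLetter_inv, count_inv]

/-- The length of a product with a letter that does not cancel. -/
theorem length_mul_ofLetter {g : BigFreeGroup A} {x : Letter A} (h : ¬ g.EndsIn x.inv) :
    (g * ofLetter x).length = g.length + (ofLetter x).length := by
  rw [length_eq_add_iff]
  intro a
  obtain ⟨p, ⟨i, hi, hl⟩, ⟨j, hj, hl'⟩, hp⟩ :=
    g.reducedForm_isReduced.inverse.exists_isPrefix (isReduced_single x)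
  -- A letter in the common initial segment of `g⁻¹` and `x` would be the first letter `x` of `g⁻¹`,
  -- making `x⁻¹` the last letter of `g`.
  have : IsEmpty p.carrier := by
    refine ⟨fun s => h ⟨OrderDual.ofDual (i s), fun r => ?_, ?_⟩⟩
    · by_contra hr
      obtain ⟨t, ht⟩ := hi (show OrderDual.toDual r ≤ i s from (not_le.1 hr).le) ⟨s, rfl⟩
      have e : t = s := j.injective rfl
      rw [e] at ht
      exact hr (le_of_eq (congrArg OrderDual.ofDual ht).symm)
    · have h1 : (g.reducedForm.letter (OrderDual.ofDual (i s))).inv = p.letter s := hl s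
      have h2 : x = p.letter s := hl' s
      rw [h2, ← h1, Letter.inv_inv]
  have hp0 : p.count a = 0 := by
    have : {s | (p.letter s).1 = a} = ∅ := eq_empty_iff_forall_notMem.2 fun s => isEmptyElim s
    rw [TransfiniteWord.count, this, ncard_empty]
  have := hp a
  rw [hp0, TransfiniteWord.mk_inverse, mk_reducedForm, inv_inv, TransfiniteWord.count_inverse,
    ← count_mk (isReduced_single x)] at this
  exact this

/-- The length of a product with a letter that cancels. -/
theorem EndsIn.length_eq {g : BigFreeGroup A} {y : Letter A} (h : g.EndsIn y) :
    g.length = (g * (ofLetter y)⁻¹).length + (ofLetter y).length := by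
  obtain ⟨s, hs, hy⟩ := h
  rw [length_eq_add_iff]
  intro a
  let p := g.reducedForm.restrict {s}ᶜ
  let i : p.carrier ↪o g.reducedForm.carrier := OrderEmbedding.subtype _
  have hi : IsLowerSet (range i) := by
    rintro _ r hle ⟨t, rfl⟩
    refine ⟨⟨r, fun e : r = s => ?_⟩, rfl⟩
    rw [e] at hle
    exact t.2 (le_antisymm (hs _) hle)
  have hp : p.IsReduced := g.reducedForm_isReduced.of_ordConnected i (fun _ => rfl)
    hi.ordConnected
  obtain ⟨e, he⟩ := TransfiniteWord.exists_orderIso_concat i hi (fun _ => rfl)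
    (S := {s}) Subtype.range_coe
  have h1 := TransfiniteWord.mk_eq_of_orderIso e he
  have h2 := TransfiniteWord.count_eq_of_orderIso e he a
  let f : PUnit.{u + 1} ≃o ({s} : Set g.reducedForm.carrier) :=
    ⟨Equiv.ofUnique _ _, fun {a b} => iff_of_true le_rfl le_rfl⟩
  have hf : ∀ t, (g.reducedForm.restrict {s}).letter (f t) = (TransfiniteWord.single y).letter t :=
    fun t => hy
  have h3 := TransfiniteWord.mk_eq_of_orderIso
    (w := g.reducedForm.restrict {s}) (v := TransfiniteWord.single y) f hf
  have h4 := TransfiniteWord.count_eq_of_orderIso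
    (w := g.reducedForm.restrict {s}) (v := TransfiniteWord.single y) f hf a
  rw [mk_reducedForm, TransfiniteWord.mk_concat, h3] at h1
  have h5 : g * (ofLetter y)⁻¹ = mk p := mul_inv_eq_of_eq_mul h1
  rw [h5, count_mk hp]
  rw [TransfiniteWord.count_concat, h4, ← count_mk (isReduced_single y)] at h2
  exact h2

/-! ### The metric of the big free group -/

/-- The left invariant `ℝ^o`-metric of the big free group. -/
noncomputable def lambdaDist (g h : BigFreeGroup A) : RealPow A := (g⁻¹ * h).length

theorem lambdaDist_mul_left (g a b : BigFreeGroup A) :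
    lambdaDist (g * a) (g * b) = lambdaDist a b := by
  rw [lambdaDist, lambdaDist]
  congr 1
  group

theorem lambdaDist_one_left (g : BigFreeGroup A) : lambdaDist 1 g = g.length := by
  rw [lambdaDist, inv_one, one_mul]

theorem lambdaDist_mul_right (g h : BigFreeGroup A) : lambdaDist g (g * h) = h.length := by
  rw [lambdaDist, inv_mul_cancel_left]

theorem gromovProduct_one (g h : BigFreeGroup A) :
    gromovProduct lambdaDist 1 g h = g.overlap h := by
  rw [gromovProduct, overlap, lambdaDist_one_left, lambdaDist_one_left, lambdaDist]

variable [LinearOrder A] [WellFoundedLT A]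

theorem realPow_le_of_forall {x y : RealPow A} (h : ∀ a, ofLex x a ≤ ofLex y a) : x ≤ y :=
  Pi.toLex_monotone (a := ofLex x) (b := ofLex y) h

theorem length_ofLetter_pos (x : Letter A) : 0 < (ofLetter x).length := by
  classical
  refine lt_of_le_of_ne (realPow_le_of_forall fun a => ?_) fun e => ?_
  · rw [ofLex_length]
    exact Nat.cast_nonneg _
  · have := congrFun (congrArg ofLex e) x.1
    rw [ofLex_length, count_ofLetter, if_pos rfl] at this
    exact zero_ne_one (α := ℝ) (this.trans Nat.cast_one)

/-- Otherwise appending `x` and then `x⁻¹` would shorten the word twice. This makes the reversed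
edge in the action formula a legitimate representation. -/
theorem EndsIn.not_endsIn_mul {g : BigFreeGroup A} {x : Letter A} (h : g.EndsIn x.inv) :
    ¬ (g * ofLetter x).EndsIn x := by
  intro h'
  have h1 := h.length_eq
  have h2 := h'.length_eq
  rw [ofLetter_inv, inv_inv, ← ofLetter_inv, length_ofLetter_inv] at h1
  rw [mul_inv_cancel_right, h1] at h2
  have h3 := length_ofLetter_pos x
  exact absurd h2 ((lt_add_of_pos_right _ h3).trans (lt_add_of_pos_right _ h3)).ne

/-- All axioms hold coordinate by coordinate for letter counts, and coordinatewise inequalities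
imply lexicographic ones. -/
theorem isLambdaMetric_lambdaDist : IsLambdaMetric (lambdaDist (A := A)) := by
  refine ⟨?_, ?_, ?_, ?_⟩
  · intro g h
    refine realPow_le_of_forall fun a => ?_
    rw [lambdaDist, ofLex_length]
    exact Nat.cast_nonneg _
  · intro g h
    constructor
    · intro e
      refine inv_mul_eq_one.1 (eq_one_of_count fun a => ?_)
      have := congrFun (congrArg ofLex e) a
      rw [lambdaDist, ofLex_length] at this
      exact Nat.cast_eq_zero.1 this
    · rintro rfl
      apply ofLex_inj.1
      funext a
      rw [lambdaDist, inv_mul_cancel, ofLex_length, count_one]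
      exact Nat.cast_zero
  · intro g h
    apply ofLex_inj.1
    funext a
    rw [lambdaDist, lambdaDist, ofLex_length, ofLex_length, ← count_inv]
    congr 2
    group
  · intro g h k
    refine realPow_le_of_forall fun a => ?_
    rw [ofLex_add, Pi.add_apply, lambdaDist, lambdaDist, lambdaDist, ofLex_length, ofLex_length,
      ofLex_length]
    have := count_mul_le (g⁻¹ * k) (k⁻¹ * h) a
    rw [mul_assoc, mul_inv_cancel_left] at this
    exact_mod_cast this

/-- The length of a transfinite word. -/
noncomputable def wordLength (w : TransfiniteWord A) : RealPow A := toLex fun a => (w.count a : ℝ)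

theorem wordLength_le_overlap {p : TransfiniteWord A} {g h : BigFreeGroup A}
    (hg : p.IsPrefix g.reducedForm) (hh : p.IsPrefix h.reducedForm) :
    wordLength p ≤ g.overlap h := by
  have h1 : wordLength p + wordLength p + (g⁻¹ * h).length ≤ g.length + h.length := by
    refine realPow_le_of_forall fun a => ?_
    rw [ofLex_add, ofLex_add, ofLex_add, Pi.add_apply, Pi.add_apply, Pi.add_apply, ofLex_length,
      ofLex_length, ofLex_length]
    have := hg.count_add_le hh a
    rw [mk_reducedForm, mk_reducedForm] at this
    change (p.count a : ℝ) + p.count a + _ ≤ (g.reducedForm.count a : ℝ) + h.reducedForm.count a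
    norm_cast
    omega
  have h2 := gromovProduct_add_self lambdaDist 1 g h
  rw [gromovProduct_one, lambdaDist_one_left, lambdaDist_one_left, lambdaDist] at h2
  exact le_of_add_self_add_le h1 h2

theorem exists_wordLength_eq_overlap (g h : BigFreeGroup A) :
    ∃ p : TransfiniteWord A, p.IsPrefix g.reducedForm ∧ p.IsPrefix h.reducedForm ∧
      wordLength p = g.overlap h := by
  obtain ⟨p, hg, hh, e⟩ := g.reducedForm_isReduced.exists_isPrefix h.reducedForm_isReduced
  refine ⟨p, hg, hh, ?_⟩
  have h1 : wordLength p + wordLength p + (g⁻¹ * h).length = g.length + h.length := by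
    apply ofLex_inj.1
    funext a
    rw [ofLex_add, ofLex_add, ofLex_add, Pi.add_apply, Pi.add_apply, Pi.add_apply, ofLex_length,
      ofLex_length, ofLex_length]
    have := e a
    rw [mk_reducedForm, mk_reducedForm] at this
    change (p.count a : ℝ) + p.count a + _ = (g.reducedForm.count a : ℝ) + h.reducedForm.count a
    norm_cast
    omega
  have h2 := gromovProduct_add_self lambdaDist 1 g h
  rw [gromovProduct_one, lambdaDist_one_left, lambdaDist_one_left, lambdaDist] at h2
  grind

/-- The longest common prefixes of `x, z` and of `y, z` are both prefixes of `z`. The shorter one is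
therefore common to `x` and `y`. -/
theorem isLambdaHyperbolic_lambdaDist : IsLambdaHyperbolic (lambdaDist (A := A)) 0 := by
  refine isLambdaMetric_lambdaDist.isLambdaHyperbolic_of_basepoint 1 fun x y z => ?_
  rw [gromovProduct_one, gromovProduct_one, gromovProduct_one]
  obtain ⟨p, hp, hp', e1⟩ := exists_wordLength_eq_overlap x z
  obtain ⟨q, hq, hq', e2⟩ := exists_wordLength_eq_overlap y z
  rcases hp'.total hq' with h | h
  · exact (min_le_left _ _).trans (e1 ▸ wordLength_le_overlap hp (h.trans hq))
  · exact (min_le_right _ _).trans (e2 ▸ wordLength_le_overlap (h.trans hp) hq)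

end BigFreeGroup

/-! ### Points of `X` on segments of the spanned tree -/

section SegmentDist

variable {Λ : Type*} [AddCommGroup Λ] [LinearOrder Λ] [Module ℝ Λ] [IsOrderedAddMonoid Λ]
  {X : Type*} {d : X → X → Λ}

theorem segmentDist_zero (hd : IsLambdaMetric d) (a b : X) : segmentDist d a b 0 = d a := by
  funext k
  have := hd.gromovProduct_nonneg a k b
  simp [segmentDist, this]

theorem segmentDist_dist (hd : IsLambdaMetric d) (a b : X) : segmentDist d a b (d a b) = d b := by
  rw [segmentDist_reverse hd, sub_self, segmentDist_zero hd]

/-- A segment may be reparametrised from a vertex which it passes through. -/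
theorem segmentDist_add (hd : IsLambdaMetric d) (h : IsLambdaHyperbolic d 0) {a b c : X} {s : Λ}
    (hc : d a c + d c b = d a b) (hs : 0 ≤ s) :
    segmentDist d a b (d a c + s) = segmentDist d c b s := by
  have e := gromovProduct_add_self d b a c
  have s1 := hd.symm a b
  have s2 := hd.symm c b
  rw [segmentDist_reverse hd, segmentDist_eq_of_le hd h (c := c) (by grind),
    segmentDist_reverse hd]
  congr 1
  grind

theorem segmentDist_of_le_dist (hd : IsLambdaMetric d) (h : IsLambdaHyperbolic d 0) {a b c : X}
    (hc : d a c + d c b = d a b) : segmentDist d a b (d a c) = d c := by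
  have := segmentDist_add hd h hc le_rfl
  rwa [add_zero, segmentDist_zero hd] at this

end SegmentDist

/-- Vanishing of the tree distance returns the rule by which points are identified: equal heights,
not above the overlap. -/
theorem le_of_add_sub_two_nsmul_min_eq_zero {Λ : Type*} [AddCommGroup Λ] [LinearOrder Λ]
    [IsOrderedAddMonoid Λ] {r s c : Λ} (hrs : r = s)
    (h : r + s - 2 • min r (min s c) = 0) : r ≤ c := by
  grind

theorem eq_of_add_sub_two_nsmul_min_eq_zero {Λ : Type*} [AddCommGroup Λ] [LinearOrder Λ]
    [IsOrderedAddMonoid Λ] {r s c : Λ}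
    (h : r + s - 2 • min r (min s c) = 0) : r = s := by
  grind

namespace BigFreeGroup

variable {A : Type u}

/-- A complete cancellation of `xx` would pair `x` with an inverse letter. -/
theorem ofLetter_mul_self_ne_one (x : Letter A) : ofLetter x * ofLetter x ≠ 1 := by
  intro h
  obtain ⟨star, hs⟩ := TransfiniteWord.pairable_univ_of_mk_eq_one
    (w := (TransfiniteWord.single x).concat (TransfiniteWord.single x)) h
  have key : ∀ t, ((TransfiniteWord.single x).concat (TransfiniteWord.single x)).letter t = x := by
    rintro (t | t) <;> rfl
  have := hs.letter (TransfiniteWord.inl _ _ PUnit.unit) (mem_univ _)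
  rw [key, key] at this
  exact Letter.inv_ne x this.symm

theorem lambdaDist_add_of_not_endsIn {v : BigFreeGroup A} {x : Letter A}
    (hv : ¬ v.EndsIn x.inv) :
    lambdaDist 1 v + lambdaDist v (v * ofLetter x) = lambdaDist 1 (v * ofLetter x) := by
  rw [lambdaDist_one_left, lambdaDist_mul_right, lambdaDist_one_left, length_mul_ofLetter hv]

variable [LinearOrder A] [WellFoundedLT A]

theorem smul_length_mem (g : BigFreeGroup A) {t : ℝ} (ht : t ∈ Icc (0 : ℝ) 1) :
    t • g.length ∈ Icc 0 g.length := by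
  have h : ∀ a, (0 : ℝ) ≤ ofLex g.length a := fun a => by
    rw [ofLex_length]
    exact Nat.cast_nonneg _
  exact ⟨realPow_le_of_forall fun a => mul_nonneg ht.1 (h a),
    realPow_le_of_forall fun a => mul_le_of_le_one_left (h a) ht.2⟩

theorem length_nonneg (g : BigFreeGroup A) : 0 ≤ g.length := by
  have := isLambdaMetric_lambdaDist.nonneg 1 g
  rwa [lambdaDist_one_left] at this

theorem smul_length_ofLetter_pos (x : Letter A) {t : ℝ} (ht : t ∈ Ioo (0 : ℝ) 1) :
    0 < t • (ofLetter x).length := by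
  refine lt_of_le_of_ne (smul_length_mem _ (Ioo_subset_Icc_self ht)).1 fun e => ?_
  have := (smul_eq_zero_iff_right ht.1.ne').1 e.symm
  exact (length_ofLetter_pos x).ne' this

theorem length_ofLetter_mul_self (x : Letter A) :
    (ofLetter x * ofLetter x).length = (ofLetter x).length + (ofLetter x).length := by
  refine length_mul_ofLetter fun h => ofLetter_mul_self_ne_one x ?_
  have := h.length_eq
  rw [ofLetter_inv, inv_inv, ← ofLetter_inv, length_ofLetter_inv] at this
  have h0 := right_eq_add.1 this
  refine ((isLambdaMetric_lambdaDist.eq_zero_iff 1 _).1 ?_).symm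
  rw [lambdaDist_one_left, h0]

end BigFreeGroup

/-! ### The big Cayley graph inside the spanned tree -/

open BigFreeGroup

namespace BigCayleyGraph

variable {A : Type u} [LinearOrder A] [WellFoundedLT A]

theorem height_mem (P : BigCayleyGraph A) : P.1.height ∈ Icc 0 (lambdaDist 1 P.1.endWord) := by
  rw [lambdaDist_one_left]
  obtain ⟨w | ⟨w, x, t⟩, hP⟩ := P
  · exact ⟨length_nonneg w, le_rfl⟩
  · have h := smul_length_mem (ofLetter x) (t := t) ⟨hP.1.le, hP.2.1.le⟩
    refine ⟨add_nonneg (length_nonneg w) h.1, ?_⟩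
    change _ ≤ (w * ofLetter x).length
    rw [length_mul_ofLetter hP.2.2]
    exact add_le_add le_rfl h.2

/-- The embedding of the big Cayley graph in the tree spanned by the big free group. -/
noncomputable def toTree (P : BigCayleyGraph A) : SpanTree (lambdaDist (A := A)) :=
  SpanTree.point lambdaDist 1 P.1.endWord P.1.height P.height_mem

theorem dist_toTree (P Q : BigCayleyGraph A) :
    SpanTree.dist lambdaDist P.toTree Q.toTree = bigDist P Q := by
  rw [toTree, toTree, SpanTree.dist_point isLambdaMetric_lambdaDist isLambdaHyperbolic_lambdaDist,
    gromovProduct_one]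
  rfl

theorem toTree_vertex (w : BigFreeGroup A) : (vertex w).toTree.1 = lambdaDist w := by
  have := segmentDist_dist isLambdaMetric_lambdaDist 1 w
  rwa [lambdaDist_one_left] at this

theorem toTree_edge (w : BigFreeGroup A) (x : Letter A) (t : ℝ) (ht : t ∈ Ioo (0 : ℝ) 1)
    (hw : ¬ w.EndsIn x.inv) :
    (edge w x t ht hw).toTree.1 =
      segmentDist lambdaDist w (w * ofLetter x) (t • (ofLetter x).length) := by
  have := segmentDist_add isLambdaMetric_lambdaDist isLambdaHyperbolic_lambdaDist
    (lambdaDist_add_of_not_endsIn hw) (smul_length_mem (ofLetter x) (Ioo_subset_Icc_self ht)).1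
  rwa [lambdaDist_one_left] at this

theorem toTree_edge_self (w : BigFreeGroup A) (x : Letter A) (t : ℝ) (ht : t ∈ Ioo (0 : ℝ) 1)
    (hw : ¬ w.EndsIn x.inv) :
    (edge w x t ht hw).toTree.1 w = t • (ofLetter x).length := by
  rw [toTree_edge]
  have h := (smul_length_ofLetter_pos x ht).le
  have e := gromovProduct_add_self lambdaDist w w (w * ofLetter x)
  have e' := isLambdaMetric_lambdaDist.dist_self w
  rw [e', zero_add, sub_self] at e
  have e0 : gromovProduct lambdaDist w w (w * ofLetter x) = 0 := self_eq_neg.1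
    (eq_neg_of_add_eq_zero_left e)
  rw [segmentDist, e0, min_eq_right h, e', zero_add, nsmul_zero, sub_zero]

/-- Vertices have integral distances to `w`, while the distance of the edge point to `w` has the
coordinate `t` with `0 < t < 1`. -/
theorem toTree_vertex_ne_edge (v w : BigFreeGroup A) (x : Letter A) (t : ℝ)
    (ht : t ∈ Ioo (0 : ℝ) 1) (hw : ¬ w.EndsIn x.inv) :
    (vertex v).toTree ≠ (edge w x t ht hw).toTree := by
  classical
  intro e
  have h := congrFun (congrArg Subtype.val e) w
  rw [toTree_vertex, toTree_edge_self, lambdaDist] at h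
  have h1 := congrFun (congrArg ofLex h) x.1
  rw [ofLex_length, ofLex_smul, Pi.smul_apply, ofLex_length, count_ofLetter, if_pos rfl,
    smul_eq_mul, Nat.cast_one, mul_one] at h1
  have h2 := ht.1
  have h3 := ht.2
  rw [← h1] at h2 h3
  have h4 : 0 < (v⁻¹ * w).count x.1 := by exact_mod_cast h2
  have h5 : (v⁻¹ * w).count x.1 < 1 := by exact_mod_cast h3
  omega

/-- Two edge points at distance zero have equal heights. Integrality of letter counts recovers the
generator and `t`; the overlap then recovers the initial vertex and the direction. -/
theorem toTree_injective : Function.Injective (toTree (A := A)) := by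
  classical
  have hM := isLambdaMetric_lambdaDist (A := A)
  have hH := isLambdaHyperbolic_lambdaDist (A := A)
  rintro ⟨w | ⟨w, x, t⟩, hP⟩ ⟨v | ⟨v, y, s⟩, hQ⟩ e
  · have h := congrFun (congrArg Subtype.val e) v
    have h1 := toTree_vertex w
    have h2 := toTree_vertex v
    have h3 : lambdaDist w v = lambdaDist v v := by
      rw [← h1, ← h2]
      exact h
    rw [hM.dist_self, hM.eq_zero_iff] at h3
    subst h3
    rfl
  · exact absurd e (toTree_vertex_ne_edge w v y s ⟨hQ.1, hQ.2.1⟩ hQ.2.2)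
  · exact absurd e.symm (toTree_vertex_ne_edge v w x t ⟨hP.1, hP.2.1⟩ hP.2.2)
  · have h0 := dist_toTree (A := A) ⟨_, hP⟩ ⟨_, hQ⟩
    rw [e, (SpanTree.isLambdaMetric hM hH).dist_self] at h0
    obtain ⟨ht0, ht1, hw⟩ := hP
    obtain ⟨hs0, hs1, hv⟩ := hQ
    have hr : w.length + t • (ofLetter x).length = v.length + s • (ofLetter y).length :=
      eq_of_add_sub_two_nsmul_min_eq_zero h0.symm
    have hc : w.length + t • (ofLetter x).length ≤
        (w * ofLetter x).overlap (v * ofLetter y) :=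
      le_of_add_sub_two_nsmul_min_eq_zero hr h0.symm
    have hcoord : ∀ a, (w.count a : ℝ) + t * ((if a = x.1 then 1 else 0 : ℕ) : ℝ) =
        v.count a + s * ((if a = y.1 then 1 else 0 : ℕ) : ℝ) := by
      intro a
      have := congrFun (congrArg ofLex hr) a
      rwa [ofLex_add, ofLex_add, Pi.add_apply, Pi.add_apply, ofLex_smul, ofLex_smul, Pi.smul_apply,
        Pi.smul_apply, ofLex_length, ofLex_length, ofLex_length, ofLex_length, count_ofLetter,
        count_ofLetter, smul_eq_mul, smul_eq_mul] at this
    have hxy : x.1 = y.1 := by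
      by_contra hne
      have := hcoord x.1
      rw [if_pos rfl, if_neg hne, Nat.cast_one, Nat.cast_zero, mul_one, mul_zero, add_zero] at this
      have h1 : (w.count x.1 : ℝ) < v.count x.1 := by linarith
      have h2 : (v.count x.1 : ℝ) < w.count x.1 + 1 := by linarith
      norm_cast at h1 h2
      omega
    have hts : t = s := by
      have := hcoord x.1
      rw [if_pos rfl, if_pos hxy, Nat.cast_one, mul_one, mul_one] at this
      have h1 : (w.count x.1 : ℝ) < v.count x.1 + 1 := by linarith
      have h2 : (v.count x.1 : ℝ) < w.count x.1 + 1 := by linarith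
      norm_cast at h1 h2
      have h3 : w.count x.1 = v.count x.1 := by omega
      rw [h3] at this
      exact add_left_cancel this
    subst hts
    have hlen : w.length = v.length := by
      apply ofLex_inj.1
      funext a
      have := hcoord a
      rw [← hxy] at this
      rw [ofLex_length, ofLex_length]
      exact add_right_cancel this
    have hpos := smul_length_ofLetter_pos x ⟨ht0, ht1⟩
    -- The words `wx` and `vy` agree strictly beyond `L(w) = L(v)`. The weak inequality yields `w =
    -- v`; the strict one excludes `y = x⁻¹`, where the overlap is exactly `L(w)`.
    have hlt : w.length < (w * ofLetter x).overlap (v * ofLetter y) :=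
      (lt_add_of_pos_right _ hpos).trans_le hc
    have hwv : w = v := by
      refine hM.eq_of_le_gromovProduct hH (lambdaDist_add_of_not_endsIn hw)
        (lambdaDist_add_of_not_endsIn hv) ?_ ?_
      · rw [lambdaDist_one_left, lambdaDist_one_left, hlen]
      · rw [lambdaDist_one_left, gromovProduct_one]
        exact hlt.le
    subst hwv
    have hxy' : x = y := by
      by_contra hne
      have hy : y = x.inv := by
        obtain ⟨a, p⟩ := x
        obtain ⟨b, q⟩ := y
        obtain rfl : a = b := hxy
        have hpq : p ≠ q := fun h => hne (by rw [h])
        cases p <;> cases q <;> simp_all [Letter.inv]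
      subst hy
      have h1 : lambdaDist (w * ofLetter x) (w * ofLetter x.inv) =
          (ofLetter x).length + (ofLetter x).length := by
        rw [lambdaDist_mul_left, lambdaDist, ← ofLetter_inv, length_ofLetter_mul_self,
          length_ofLetter_inv]
      have h2 := gromovProduct_add_self lambdaDist 1 (w * ofLetter x) (w * ofLetter x.inv)
      rw [h1, gromovProduct_one, lambdaDist_one_left, lambdaDist_one_left,
        length_mul_ofLetter hw, length_mul_ofLetter hv, length_ofLetter_inv,
        add_add_add_comm, add_sub_cancel_right] at h2
      exact absurd h2 (add_lt_add hlt hlt).ne'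
    subst hxy'
    rfl

theorem isPoint_act (g : BigFreeGroup A) (P : BigCayleyGraph A) : (P.1.act g).IsPoint := by
  obtain ⟨w | ⟨w, x, t⟩, hP⟩ := P
  · trivial
  · rw [CayleySymbol.act]
    split_ifs with h
    · refine ⟨sub_pos.2 hP.2.1, sub_lt_self _ hP.1, ?_⟩
      rw [Letter.inv_inv]
      exact h.not_endsIn_mul
    · exact ⟨hP.1, hP.2.1, h⟩

/-- Translation carries the segment from `w` to `wx` to that from `gw` to `gwx`. When `gw` ends in
`x⁻¹`, the action formula describes the same segment from its other end, with `1 - t`. -/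
theorem toTree_act (g : BigFreeGroup A) (P : BigCayleyGraph A) :
    letI := SpanTree.mulAction (lambdaDist_mul_left (A := A))
    toTree ⟨P.1.act g, isPoint_act g P⟩ = g • P.toTree := by
  classical
  have hM := isLambdaMetric_lambdaDist (A := A)
  obtain ⟨w | ⟨w, x, t⟩, hP⟩ := P
  · refine Subtype.ext (funext fun k => ?_)
    refine (congrFun (toTree_vertex (g * w)) k).trans ?_
    refine Eq.trans ?_ (congrFun (toTree_vertex w) (g⁻¹ * k)).symm
    rw [← lambdaDist_mul_left g w, mul_inv_cancel_left]
  · have ht : t ∈ Ioo (0 : ℝ) 1 := ⟨hP.1, hP.2.1⟩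
    refine Subtype.ext (funext fun k => ?_)
    refine Eq.trans ?_ (congrFun (toTree_edge w x t ht hP.2.2) (g⁻¹ * k)).symm
    rw [← segmentDist_smul lambdaDist_mul_left, ← mul_assoc]
    have hact : (CayleySymbol.edge w x t).act g =
      if (g * w).EndsIn x.inv then CayleySymbol.edge (g * w * ofLetter x) x.inv (1 - t)
      else CayleySymbol.edge (g * w) x t := rfl
    by_cases h : (g * w).EndsIn x.inv
    · have hn : ¬ (g * w * ofLetter x).EndsIn x.inv.inv := by
        rw [Letter.inv_inv]
        exact h.not_endsIn_mul
      have ht' : 1 - t ∈ Ioo (0 : ℝ) 1 := ⟨sub_pos.2 ht.2, sub_lt_self _ ht.1⟩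
      have e : (⟨(CayleySymbol.edge w x t).act g, isPoint_act g ⟨_, hP⟩⟩ : BigCayleyGraph A) =
          edge (g * w * ofLetter x) x.inv (1 - t) ht' hn :=
        Subtype.ext (hact.trans (if_pos h))
      rw [e, toTree_edge, segmentDist_reverse hM (g * w), length_ofLetter_inv, ofLetter_inv,
        mul_inv_cancel_right, lambdaDist_mul_right, sub_smul, one_smul]
    · have e : (⟨(CayleySymbol.edge w x t).act g, isPoint_act g ⟨_, hP⟩⟩ : BigCayleyGraph A) =
          edge (g * w) x t ht h :=
        Subtype.ext (hact.trans (if_neg h))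
      rw [e, toTree_edge]

/-- The action of the big free group on the big Cayley graph. -/
noncomputable abbrev mulAction : MulAction (BigFreeGroup A) (BigCayleyGraph A) where
  smul g P := ⟨P.1.act g, isPoint_act g P⟩
  one_smul P := by
    -- The action axioms hold for functions on the group and are pulled back along the injective
    -- equivariant map, with no case analysis on last letters.
    refine toTree_injective ?_
    exact (toTree_act 1 P).trans
      ((SpanTree.mulAction (lambdaDist_mul_left (A := A))).one_smul P.toTree)
  mul_smul g h P := by
    refine toTree_injective ?_
    let := SpanTree.mulAction (lambdaDist_mul_left (A := A))
    refine (toTree_act (g * h) P).trans ((mul_smul g h P.toTree).trans ?_)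
    rw [← toTree_act h P]
    exact (toTree_act g _).symm

end BigCayleyGraph

/-! ### Integral lengths and geodesics from `1` -/

namespace IntPow

variable {A : Type u}

theorem toReal_add (m n : IntPow A) : (m + n).toReal = m.toReal + n.toReal := by
  apply ofLex_inj.1
  funext a
  exact Int.cast_add _ _

theorem toReal_zero : (0 : IntPow A).toReal = 0 := by
  apply ofLex_inj.1
  funext a
  exact Int.cast_zero

theorem toReal_injective : Function.Injective (toReal (A := A)) := by
  intro m n h
  apply ofLex_inj.1
  funext a
  have := congrFun (congrArg ofLex h) a
  simpa [toReal] using this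

theorem toReal_strictMono [LinearOrder A] [WellFoundedLT A] : StrictMono (toReal (A := A)) := by
  rintro m n ⟨a, h1, h2⟩
  refine ⟨a, fun b hb => ?_, ?_⟩
  · exact congrArg (Int.cast (R := ℝ)) (h1 b hb)
  · exact Int.cast_lt.2 h2

end IntPow

namespace BigFreeGroup

variable {A : Type u}

theorem lengthZ_mul_ofLetter {v : BigFreeGroup A} {x : Letter A} (hv : ¬ v.EndsIn x.inv) :
    (v * ofLetter x).lengthZ = v.lengthZ + (ofLetter x).lengthZ := by
  apply IntPow.toReal_injective
  rw [IntPow.toReal_add]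
  exact length_mul_ofLetter hv

theorem mem_Icc_lambdaDist [LinearOrder A] {w : BigFreeGroup A} {r : RealPow A} (hr : r ∈ Icc 0 w.length) :
    r ∈ Icc 0 (lambdaDist 1 w) := by
  rwa [lambdaDist_one_left]

variable [LinearOrder A] [WellFoundedLT A]

/-- The points of the real interval and of the integral interval between `v` and `v x`. -/
theorem segment_inter_segment {v : BigFreeGroup A} {x : Letter A} (hv : ¬ v.EndsIn x.inv) :
    {r : RealPow A | ∃ t ∈ Icc (0 : ℝ) 1, r = v.length + t • (ofLetter x).length} ∩
        {r : RealPow A | ∃ n ∈ Icc 0 (ofLetter x).lengthZ, r = (v.lengthZ + n).toReal} =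
      {v.length, (v * ofLetter x).length} := by
  classical
  ext r
  constructor
  · rintro ⟨⟨t, ht, rfl⟩, n, -, e⟩
    rw [IntPow.toReal_add] at e
    have e' : t • (ofLetter x).length = n.toReal := add_left_cancel e
    -- The coordinate at the generator of `x` is `t` on one side and an integer on the other, so `t`
    -- is `0` or `1`.
    have h := congrFun (congrArg ofLex e') x.1
    rw [ofLex_smul, Pi.smul_apply, ofLex_length, count_ofLetter, if_pos rfl, smul_eq_mul,
      Nat.cast_one, mul_one] at h
    have h' : t = ((ofLex n x.1 : ℤ) : ℝ) := h
    obtain ⟨h0, h1⟩ := ht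
    rw [h'] at h0 h1
    have h2 : ofLex n x.1 = 0 ∨ ofLex n x.1 = 1 := by
      have : 0 ≤ ofLex n x.1 := by exact_mod_cast h0
      have : ofLex n x.1 ≤ 1 := by exact_mod_cast h1
      omega
    rcases h2 with h2 | h2
    · rw [h', h2]
      simp
    · rw [h', h2, length_mul_ofLetter hv]
      simp
  · have hn := (ofLetter x).lengthZ_nonneg
    rintro (rfl | rfl)
    · refine ⟨⟨0, ⟨le_rfl, zero_le_one⟩, by simp⟩, 0, ⟨le_rfl, hn⟩, ?_⟩
      rw [add_zero]
      rfl
    · refine ⟨⟨1, ⟨zero_le_one, le_rfl⟩, ?_⟩, _, ⟨hn, le_rfl⟩, ?_⟩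
      · rw [one_smul, length_mul_ofLetter hv]
      · rw [← lengthZ_mul_ofLetter hv]
        rfl

open scoped Classical in
/-- The geodesic from `1` to `w` in the tree spanned by the big free group. -/
noncomputable def geodesic (w : BigFreeGroup A) (r : RealPow A) :
    SpanTree (lambdaDist (A := A)) :=
  if h : r ∈ Icc 0 w.length then SpanTree.point lambdaDist 1 w r (mem_Icc_lambdaDist h)
  else (BigCayleyGraph.vertex 1).toTree

theorem geodesic_eq {w : BigFreeGroup A} {r : RealPow A} (h : r ∈ Icc 0 w.length) :
    w.geodesic r = SpanTree.point lambdaDist 1 w r (mem_Icc_lambdaDist h) :=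
  dif_pos h

theorem isGeodesicOn_geodesic (w : BigFreeGroup A) :
    IsGeodesicOn (SpanTree.dist lambdaDist) 0 w.length w.geodesic := by
  intro s hs t ht
  rw [geodesic_eq hs, geodesic_eq ht,
    SpanTree.dist_point_self isLambdaMetric_lambdaDist isLambdaHyperbolic_lambdaDist]

theorem geodesic_zero (w : BigFreeGroup A) : w.geodesic 0 = (BigCayleyGraph.vertex 1).toTree := by
  rw [geodesic_eq ⟨le_rfl, length_nonneg w⟩]
  refine Subtype.ext ?_
  rw [BigCayleyGraph.toTree_vertex]
  exact segmentDist_zero isLambdaMetric_lambdaDist 1 w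

theorem geodesic_length (w : BigFreeGroup A) :
    w.geodesic w.length = (BigCayleyGraph.vertex w).toTree :=
  geodesic_eq ⟨length_nonneg w, le_rfl⟩

theorem geodesic_mul_ofLetter {v : BigFreeGroup A} {x : Letter A} (hv : ¬ v.EndsIn x.inv) :
    (v * ofLetter x).geodesic v.length = (BigCayleyGraph.vertex v).toTree := by
  have h : v.length ≤ (v * ofLetter x).length := by
    rw [length_mul_ofLetter hv]
    exact le_add_of_nonneg_right (length_nonneg _)
  rw [geodesic_eq ⟨length_nonneg v, h⟩]
  refine Subtype.ext ?_
  rw [BigCayleyGraph.toTree_vertex]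
  have := segmentDist_of_le_dist isLambdaMetric_lambdaDist isLambdaHyperbolic_lambdaDist
    (lambdaDist_add_of_not_endsIn hv)
  rwa [lambdaDist_one_left] at this

end BigFreeGroup

/-! ### The `ℤ^o`-tree inside the spanned tree -/

namespace IntTree

variable {A : Type u} [LinearOrder A] [WellFoundedLT A]

theorem mem_Icc_length (p : IntervalPoint A) : p.val.toReal ∈ Icc 0 p.word.length :=
  ⟨IntPow.toReal_zero (A := A) ▸ IntPow.toReal_strictMono.monotone p.mem.1,
    IntPow.toReal_strictMono.monotone p.mem.2⟩

/-- The embedding of the `ℤ^o`-tree in the tree spanned by the big free group. -/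
noncomputable def toTree : IntTree A → SpanTree (lambdaDist (A := A)) :=
  Quot.lift (fun p => SpanTree.point lambdaDist 1 p.word p.val.toReal
    (mem_Icc_lambdaDist (mem_Icc_length p))) (by
      rintro ⟨g, n, hn⟩ ⟨h, m, hm⟩ ⟨rfl, hle⟩
      refine Subtype.ext ?_
      refine segmentDist_eq_of_le isLambdaMetric_lambdaDist isLambdaHyperbolic_lambdaDist ?_
      rwa [gromovProduct_one])

theorem toTree_mk (p : IntervalPoint A) :
    (mk p).toTree = p.word.geodesic p.val.toReal :=
  (geodesic_eq (mem_Icc_length p)).symm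

theorem dist_toTree (p q : IntervalPoint A) :
    SpanTree.dist lambdaDist (mk p).toTree (mk q).toTree = p.dist q := by
  rw [IntervalPoint.dist, ← gromovProduct_one]
  exact SpanTree.dist_point isLambdaMetric_lambdaDist isLambdaHyperbolic_lambdaDist
    (mem_Icc_lambdaDist (mem_Icc_length p)) (mem_Icc_lambdaDist (mem_Icc_length q))

/-- Distance zero is literally the identification relation, so a single identification joins any two
representatives with the same image. -/
theorem toTree_injective : Function.Injective (toTree (A := A)) := by
  rintro ⟨p⟩ ⟨q⟩ e
  have h := dist_toTree p q
  have e' : (mk p).toTree = (mk q).toTree := e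
  rw [e', (SpanTree.isLambdaMetric isLambdaMetric_lambdaDist
    isLambdaHyperbolic_lambdaDist).dist_self, IntervalPoint.dist] at h
  have hr := eq_of_add_sub_two_nsmul_min_eq_zero h.symm
  exact Quot.sound ⟨IntPow.toReal_injective hr, le_of_add_sub_two_nsmul_min_eq_zero hr h.symm⟩

end IntTree

/-! ### Metric properties of the Cayley graph, and the main theorem -/

namespace BigCayleyGraph

variable {A : Type u} [LinearOrder A] [WellFoundedLT A]

theorem isLambdaMetric_bigDist : IsLambdaMetric (bigDist (A := A)) := by
  have h := SpanTree.isLambdaMetric (isLambdaMetric_lambdaDist (A := A))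
    isLambdaHyperbolic_lambdaDist
  refine ⟨fun P Q => ?_, fun P Q => ?_, fun P Q => ?_, fun P Q R => ?_⟩
  · rw [← dist_toTree]
    exact h.nonneg _ _
  · rw [← dist_toTree, h.eq_zero_iff]
    exact toTree_injective.eq_iff
  · rw [← dist_toTree, ← dist_toTree]
    exact h.symm _ _
  · rw [← dist_toTree, ← dist_toTree, ← dist_toTree]
    exact h.triangle _ _ _

theorem isLambdaHyperbolic_bigDist : IsLambdaHyperbolic (bigDist (A := A)) 0 := by
  have h := SpanTree.isLambdaHyperbolic (isLambdaMetric_lambdaDist (A := A))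
    isLambdaHyperbolic_lambdaDist
  intro v x y z
  have := h v.toTree x.toTree y.toTree z.toTree
  simpa only [gromovProduct, dist_toTree] using this

/-- At vertices the minimum is the overlap, a Gromov product and hence at most both lengths. -/
theorem bigDist_vertex (w v : BigFreeGroup A) :
    bigDist (vertex w) (vertex v) = (w⁻¹ * v).length := by
  have h1 := isLambdaMetric_lambdaDist.gromovProduct_le_left 1 w v
  have h2 := isLambdaMetric_lambdaDist.gromovProduct_le_right 1 w v
  have h3 := gromovProduct_add_self lambdaDist 1 w v
  rw [gromovProduct_one, lambdaDist_one_left] at h1 h2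
  rw [gromovProduct_one, lambdaDist_one_left, lambdaDist_one_left, lambdaDist] at h3
  change w.length + v.length - 2 • min w.length (min v.length (w.overlap v)) = _
  rw [min_eq_right h2, min_eq_right h1, two_nsmul, h3, sub_sub_cancel]

end BigCayleyGraph

theorem mainTheorem2 (A : Type u) [LinearOrder A] [WellFoundedLT A] :
    -- an `ℝ^o`-metric extending the metric of the big free group, and `0`-hyperbolic
    IsLambdaMetric (BigCayleyGraph.bigDist (A := A)) ∧
    (∀ w v : BigFreeGroup A,
      BigCayleyGraph.bigDist (BigCayleyGraph.vertex w) (BigCayleyGraph.vertex v) =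
        (w⁻¹ * v).length) ∧
    IsLambdaHyperbolic (BigCayleyGraph.bigDist (A := A)) 0 ∧
    -- the formula for the action defines an action, which is by isometries
    (∃ _ : MulAction (BigFreeGroup A) (BigCayleyGraph A),
      (∀ (g : BigFreeGroup A) (P : BigCayleyGraph A), (g • P).1 = P.1.act g) ∧
      (∀ (g : BigFreeGroup A) (P Q : BigCayleyGraph A),
        BigCayleyGraph.bigDist (g • P) (g • Q) = BigCayleyGraph.bigDist P Q) ∧
      -- isometric equivariant embedding in an `ℝ^o`-tree with an isometric action
      ∃ (T : Type (u + 1)) (d : T → T → RealPow A) (_ : MulAction (BigFreeGroup A) T)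
        (φ : BigCayleyGraph A → T),
        IsLambdaTree d ∧
        (∀ (g : BigFreeGroup A) (x y : T), d (g • x) (g • y) = d x y) ∧
        (∀ P Q, d (φ P) (φ Q) = BigCayleyGraph.bigDist P Q) ∧
        (∀ (g : BigFreeGroup A) (P : BigCayleyGraph A), φ (g • P) = g • φ P) ∧
        -- the interval `[0, L(w)]` of a word `w`; inside it, if `w = v x`, the real interval
        -- between `v` and `w`
        (∀ w : BigFreeGroup A, ∃ α : RealPow A → T,
          IsGeodesicOn d 0 w.length α ∧
          α 0 = φ (BigCayleyGraph.vertex 1) ∧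
          α w.length = φ (BigCayleyGraph.vertex w) ∧
          ∀ (v : BigFreeGroup A) (x : Letter A) (hv : ¬ v.EndsIn x.inv),
            w = v * BigFreeGroup.ofLetter x →
            α v.length = φ (BigCayleyGraph.vertex v) ∧
            ∀ (t : ℝ) (ht : t ∈ Ioo (0 : ℝ) 1),
              α (v.length + t • (BigFreeGroup.ofLetter x).length) =
                φ (BigCayleyGraph.edge v x t ht hv))) ∧
    -- isometric embedding of the `ℤ^o`-tree in an `ℝ^o`-tree
    (∃ (T : Type (u + 1)) (d : T → T → RealPow A) (ψ : IntTree A → T),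
      IsLambdaTree d ∧
      Function.Injective ψ ∧
      (∀ p q : IntervalPoint A, d (ψ (IntTree.mk p)) (ψ (IntTree.mk q)) = p.dist q) ∧
      -- the interval `[0, L(w)]` of a word `w`; inside it, if `w = v x`, the `ℤ^o`-interval
      -- between `v` and `w`
      (∀ w : BigFreeGroup A, ∃ α : RealPow A → T,
        IsGeodesicOn d 0 w.length α ∧
        α 0 = ψ (IntTree.ofWord 1) ∧
        α w.length = ψ (IntTree.ofWord w) ∧
        ∀ (v : BigFreeGroup A) (x : Letter A), ¬ v.EndsIn x.inv →
          w = v * BigFreeGroup.ofLetter x →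
          α v.length = ψ (IntTree.ofWord v) ∧
          ∀ n ∈ Icc 0 (BigFreeGroup.ofLetter x).lengthZ,
            ∃ h : v.lengthZ + n ∈ Icc 0 w.lengthZ,
              α (v.lengthZ + n).toReal = ψ (IntTree.mk ⟨w, v.lengthZ + n, h⟩))) ∧
    -- the real interval and the `ℤ^o`-interval between `v` and `v x` have, inside
    -- `[0, L(v x)]`, only the endpoints in common
    (∀ (v : BigFreeGroup A) (x : Letter A), ¬ v.EndsIn x.inv →
      {r : RealPow A | ∃ t ∈ Icc (0 : ℝ) 1, r = v.length + t • (BigFreeGroup.ofLetter x).length} ∩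
        {r : RealPow A | ∃ n ∈ Icc 0 (BigFreeGroup.ofLetter x).lengthZ,
          r = (v.lengthZ + n).toReal} =
        {v.length, (v * BigFreeGroup.ofLetter x).length}) := by

  have hM := isLambdaMetric_lambdaDist (A := A)
  have hH := isLambdaHyperbolic_lambdaDist (A := A)
  have hT := SpanTree.isLambdaTree hM hH
  -- The same spanned tree, with the same geodesics from `1`, serves for both embeddings.
  refine ⟨BigCayleyGraph.isLambdaMetric_bigDist, BigCayleyGraph.bigDist_vertex,
    BigCayleyGraph.isLambdaHyperbolic_bigDist,
    ⟨BigCayleyGraph.mulAction, fun _ _ => rfl, fun g P Q => ?_,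
      SpanTree (lambdaDist (A := A)), SpanTree.dist lambdaDist,
      SpanTree.mulAction lambdaDist_mul_left, BigCayleyGraph.toTree, hT,
      SpanTree.dist_smul hM hH lambdaDist_mul_left, BigCayleyGraph.dist_toTree,
      BigCayleyGraph.toTree_act, fun w => ⟨w.geodesic, w.isGeodesicOn_geodesic, w.geodesic_zero,
        w.geodesic_length, ?_⟩⟩,
    ⟨SpanTree (lambdaDist (A := A)), SpanTree.dist lambdaDist, IntTree.toTree, hT,
      IntTree.toTree_injective, IntTree.dist_toTree,
      fun w => ⟨w.geodesic, w.isGeodesicOn_geodesic, w.geodesic_zero, w.geodesic_length, ?_⟩⟩,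
    fun v x hv => segment_inter_segment hv⟩
  · rw [← BigCayleyGraph.dist_toTree, ← BigCayleyGraph.dist_toTree]
    have h1 := BigCayleyGraph.toTree_act g P
    have h2 := BigCayleyGraph.toTree_act g Q
    refine (congrArg₂ (SpanTree.dist lambdaDist) h1 h2).trans ?_
    exact SpanTree.dist_smul hM hH lambdaDist_mul_left g _ _
  · rintro v x hv rfl
    refine ⟨geodesic_mul_ofLetter hv, fun t ht => ?_⟩
    have h := (BigCayleyGraph.edge v x t ht hv).height_mem
    rw [lambdaDist_one_left] at h
    exact geodesic_eq h
  · rintro v x hv rfl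
    refine ⟨geodesic_mul_ofLetter hv, fun n hn => ?_⟩
    have h : v.lengthZ + n ∈ Icc 0 (v * BigFreeGroup.ofLetter x).lengthZ := by
      rw [lengthZ_mul_ofLetter hv]
      exact ⟨add_nonneg v.lengthZ_nonneg hn.1, add_le_add le_rfl hn.2⟩
    exact ⟨h, (IntTree.toTree_mk ⟨_, _, h⟩).symm⟩
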